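/- Let $S\in\{\frac12,1,\frac32,\dots\}$, let $\gamma\in\mathbb R$ with $2S|\gamma|<\pi$, put $q=e^{i\gamma}$ and $[t]=\frac{\sin\gamma t}{\sin\gamma}$ (with $[t]=t$ if $\gamma=0$). Let $V^S\simeq\mathbb C^{2S+1}$ be the $U_q(sl_2)$-module with orthonormal basis $\omega_k$, $k=-S,\dots,S$, on which $$E\omega_k=\sqrt{[S-k][S+k+1]}\,\omega_{k+1},\quad F\omega_k=\sqrt{[S+k][S-k+1]}\,\omega_{k-1},\quad K\omega_k=q^k\omega_k,\quad H\omega_k=k\,\omega_k ,$$ and let $U_q(sl_2)$ act on tensor products through $\Delta(E)=E\otimes K^{-1}+K\otimes E$, $\Delta(F)=F\otimes K^{-1}+K\otimes F$, $\Delta(K)=K\otimes K$. Let $\mathbb P$ be the flip of $V^S\otimes V^S$ and let $\mathsf R^\pm$ be the universal R-matrices evaluated on $V^S\otimes V^S$: $$\mathsf R^+=q^{H\otimes H}\sum_{n\ge0}\frac{q^{n(n-1)/2}}{[1]\cdots[n]}\bigl((q-q^{-1})F\otimes E\bigr)^n q^{H\otimes H},\qquad \mathsf R^-=\mathbb P(\mathsf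 R^+)^{-1}\mathbb P$$ (the sum runs over $n\le 2S$, since the later powers vanish; $\mathsf R^+$ is invertible). For an operator $\mathsf A$ on $V^S\otimes V^S$ let $\mathsf A_{nm}$ be the operator on $(V^S)^{\otimes N}$ that acts as $\mathsf A$ on the $n$-th and $m$-th tensor factors, in this order, and trivially on the others. For $\mathsf R=\mathsf R^+$ and for $\mathsf R=\mathsf R^-$ put, respectively, $$\eta_N^\pm=\overleftarrow{\mathsf R}_N\cdots\overleftarrow{\mathsf R}_2,\qquad \overleftarrow{\mathsf R}_n=\mathsf R_{n-1,n}\cdots\mathsf R_{1,n}.$$ a) Suppose in addition that $[m]\ne0$ for all integers $1\le m\le 4S$. Then $V^S\otimes V^S=\bigoplus_{s=0}^{2S}V^s$, where $V^s$ is the irreducible submodule of spin $s$ and dimension $2s+1$. Let $\mathsf P^{S,s}$ be the projector onto $V^s$ along the other summands. Then for all $n=1,\dots,N-1$ and $s=0,\dots,2S$ $$\eta_N^\pm\,\mathsf P^{S,s}_{n,n+1}=\bigl(\mathsf P^{S,s}_{n,n+1}\bigr)^*\eta_N^\pm=\mathsf P^{S,s}_{n+1,n}\,\eta_N^\pm .$$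 Hence $\eta_N^\pm\mathsf H=\mathsf H^*\eta_N^\pm$ for every Hamiltonian $\mathsf H=\sum_{n=1}^{N-1}\sum_{s=0}^{2S}b_{n,s}\mathsf P^{S,s}_{n,n+1}$ with real coefficients $b_{n,s}$. b) $\eta_N^\pm=\overrightarrow{\mathsf R}_1\cdots\overrightarrow{\mathsf R}_{N-1}$, where $\overrightarrow{\mathsf R}_n=\mathsf R_{n,n+1}\cdots\mathsf R_{n,N}$. c) $(\eta_N^+)^*=\eta_N^-$. -/

import Mathlib

open scoped Kronecker Matrix

namespace SpinChain

noncomputable section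

/-- The parameter `q = exp (i γ)`, raised to a real power: `q ^ x = exp (i γ x)`. -/
def qPow (γ x : ℝ) : ℂ := Complex.exp (Complex.I * γ * x)

/-- The q-number `[x] = sin (γ x) / sin γ`, with its limiting value `x` at `γ = 0`. -/
def qNum (γ x : ℝ) : ℝ := if γ = 0 then x else Real.sin (γ * x) / Real.sin γ

/-- The q-factorial `[1] [2] ⋯ [n]`. -/
def qFactorial (γ : ℝ) (n : ℕ) : ℝ := ∏ k ∈ Finset.range n, qNum γ ((k : ℝ) + 1)

/-! ### The spin `S` module

The spin is given by the natural number `d = 2 S`. The canonical orthonormal basis `ω_k`,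
`k = -S, …, S`, of the module is indexed by `Fin (d + 1)`; the index `i` stands for `k = i - S`.
A matrix `A` sends `ω_j` to `∑ i, A i j • ω_i`. -/

/-- The weight `k = i - S` of the `i`-th basis vector. -/
def weight (d : ℕ) (i : Fin (d + 1)) : ℝ := (i : ℝ) - (d : ℝ) / 2

/-- `E ω_k = √([S - k] [S + k + 1]) ω_{k+1}`. The square root is taken in `ℂ`, because the
q-numbers can be negative in the modules that occur inside a tensor product. -/
def spinE (γ : ℝ) (d : ℕ) : Matrix (Fin (d + 1)) (Fin (d + 1)) ℂ := fun i j =>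
  if (i : ℕ) = (j : ℕ) + 1 then
    Complex.sqrt ((qNum γ ((d : ℝ) / 2 - weight d j) * qNum γ ((d : ℝ) / 2 + weight d j + 1) : ℝ))
  else 0

/-- `F ω_k = √([S + k] [S - k + 1]) ω_{k-1}`. -/
def spinF (γ : ℝ) (d : ℕ) : Matrix (Fin (d + 1)) (Fin (d + 1)) ℂ := fun i j =>
  if (i : ℕ) + 1 = (j : ℕ) then
    Complex.sqrt ((qNum γ ((d : ℝ) / 2 + weight d j) * qNum γ ((d : ℝ) / 2 - weight d j + 1) : ℝ))
  else 0

/-- `K ω_k = q ^ k ω_k`. -/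
def spinK (γ : ℝ) (d : ℕ) : Matrix (Fin (d + 1)) (Fin (d + 1)) ℂ :=
  Matrix.diagonal fun i => qPow γ (weight d i)

/-- `K⁻¹ ω_k = q ^ (-k) ω_k`. -/
def spinKInv (γ : ℝ) (d : ℕ) : Matrix (Fin (d + 1)) (Fin (d + 1)) ℂ :=
  Matrix.diagonal fun i => qPow γ (-weight d i)

/-! ### Two sites -/

/-- Operators on the tensor square of the spin `d / 2` module, as matrices in the orthonormal
basis `ω_k ⊗ ω_m`. -/
abbrev TwoSite (d : ℕ) : Type :=
  Matrix (Fin (d + 1) × Fin (d + 1)) (Fin (d + 1) × Fin (d + 1)) ℂ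

/-- `Δ(E) = E ⊗ K⁻¹ + K ⊗ E` on the tensor square. -/
def coE (γ : ℝ) (d : ℕ) : TwoSite d := spinE γ d ⊗ₖ spinKInv γ d + spinK γ d ⊗ₖ spinE γ d

/-- `Δ(F) = F ⊗ K⁻¹ + K ⊗ F` on the tensor square. -/
def coF (γ : ℝ) (d : ℕ) : TwoSite d := spinF γ d ⊗ₖ spinKInv γ d + spinK γ d ⊗ₖ spinF γ d

/-- `Δ(K) = K ⊗ K` on the tensor square. -/
def coK (γ : ℝ) (d : ℕ) : TwoSite d := spinK γ d ⊗ₖ spinK γ d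

/-- `T` is (the matrix of) a homomorphism of `U_q(sl₂)`-modules from the spin `s` module to the
tensor square of the spin `d / 2` module. -/
def IsIntertwiner (γ : ℝ) (d s : ℕ)
    (T : Matrix (Fin (d + 1) × Fin (d + 1)) (Fin (2 * s + 1)) ℂ) : Prop :=
  coE γ d * T = T * spinE γ (2 * s) ∧
  coF γ d * T = T * spinF γ (2 * s) ∧
  coK γ d * T = T * spinK γ (2 * s)

/-- The submodule `V^s` of the tensor square of the spin `d / 2` module: the span of all the
images of module homomorphisms from the spin `s` module. -/
def subV (γ : ℝ) (d s : ℕ) : Submodule ℂ (Fin (d + 1) × Fin (d + 1) → ℂ) :=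
  ⨆ (T : Matrix (Fin (d + 1) × Fin (d + 1)) (Fin (2 * s + 1)) ℂ) (_ : IsIntertwiner γ d s T),
    LinearMap.range T.mulVecLin

open Classical in
/-- The projector `P^{S,s}` (`S = d / 2`) onto `V^s` along the sum of the other `V^l`,
`l = 0, …, 2 S`. -/
def proj (γ : ℝ) (d : ℕ) (s : Fin (d + 1)) : TwoSite d :=
  if h : IsCompl (subV γ d s) (⨆ l : {l : Fin (d + 1) // l ≠ s}, subV γ d (l : Fin (d + 1))) then
    LinearMap.toMatrix' ((subV γ d s).projection _ h)
  else 0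

/-- The flip of the two tensor factors. -/
def flip (d : ℕ) : TwoSite d := fun x y => if x = y.swap then 1 else 0

/-- `q ^ (H ⊗ H)`, where `H ω_k = k ω_k`, so that `K = q ^ H`. -/
def qHH (γ : ℝ) (d : ℕ) : TwoSite d :=
  Matrix.diagonal fun x => qPow γ (weight d x.1 * weight d x.2)

/-- The universal R-matrix
`R⁺ = q^(H ⊗ H) (∑ n, q^(n (n - 1) / 2) / [n]! ((q - q⁻¹) F ⊗ E)^n) q^(H ⊗ H)`
on the tensor square of the spin `d / 2` module; there `E ^ (d + 1) = 0`, so that the terms with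
`n > d` vanish. -/
def RPlus (γ : ℝ) (d : ℕ) : TwoSite d :=
  qHH γ d *
    (∑ n ∈ Finset.range (d + 1),
      (qPow γ ((n : ℝ) * ((n : ℝ) - 1) / 2) / (qFactorial γ n : ℂ)) •
        ((qPow γ 1 - qPow γ (-1)) • (spinF γ d ⊗ₖ spinE γ d)) ^ n) *
    qHH γ d

/-- The second R-matrix: the inverse of `R⁺` conjugated by the flip. -/
def RMinus (γ : ℝ) (d : ℕ) : TwoSite d := flip d * (RPlus γ d)⁻¹ * flip d

/-! ### The chain of `N` sites -/

/-- Operators on the `N`-th tensor power of the spin `d / 2` module, as matrices in the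
orthonormal basis of the products `ω_{x 0} ⊗ ⋯ ⊗ ω_{x (N - 1)}`. The adjoint is the conjugate
transpose. -/
abbrev Chain (N d : ℕ) : Type := Matrix (Fin N → Fin (d + 1)) (Fin N → Fin (d + 1)) ℂ

/-- The operator `A_{n m}`: the first factor of `A` acts at the site `n`, the second factor at
the site `m` (`n ≠ m`), and the other sites are left alone. -/
def embed {N d : ℕ} (A : TwoSite d) (n m : Fin N) : Chain N d := fun x y =>
  if ∀ j, j ≠ n → j ≠ m → x j = y j then A (x n, x m) (y n, y m) else 0

/-- `R_{n-1,n} ⋯ R_{1,n}`, the first index decreasing from left to right. -/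
def leftArrow {N d : ℕ} (R : TwoSite d) (n : Fin N) : Chain N d :=
  (((List.finRange N).filter (fun j => j < n)).reverse.map fun j => embed R j n).prod

/-- `R_{n,n+1} ⋯ R_{n,N}`, the second index increasing from left to right. -/
def rightArrow {N d : ℕ} (R : TwoSite d) (n : Fin N) : Chain N d :=
  (((List.finRange N).filter (fun j => n < j)).map fun j => embed R n j).prod

/-- `η_N`, the product of the `leftArrow R n` with `n` decreasing from the last site. The factor
of the first site is an empty product. -/
def eta (N : ℕ) {d : ℕ} (R : TwoSite d) : Chain N d :=
  ((List.finRange N).reverse.map fun n => leftArrow R n).prod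

/-- The product of the `rightArrow R n` with `n` increasing from the first site. The factor of
the last site is an empty product. -/
def etaOp (N : ℕ) {d : ℕ} (R : TwoSite d) : Chain N d :=
  ((List.finRange N).map fun n => rightArrow R n).prod

/-- The left site of the `n`-th bond of the chain. -/
def bondL {N : ℕ} (n : Fin (N - 1)) : Fin N := ⟨n, by omega⟩

/-- The right site of the `n`-th bond of the chain. -/
def bondR {N : ℕ} (n : Fin (N - 1)) : Fin N := ⟨n + 1, by omega⟩

/-- The Hamiltonian `∑ n, ∑ s, b_{n,s} P^{S,s}_{n,n+1}`. -/
def hamiltonian (γ : ℝ) (N d : ℕ) (b : Fin (N - 1) → Fin (d + 1) → ℝ) : Chain N d :=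
  ∑ n, ∑ s, (b n s : ℂ) • embed (proj γ d s) (bondL n) (bondR n)

end

end SpinChain

/-!
The projectors `P^{S,s}` are polynomials in the Casimir operator `C` of `V^S ⊗ V^S`, so everything
reduces to facts about `C` and the R-matrix. Reversing `γ` inverts `R⁺`, hence `R⁻` is the flip of
`R⁺` at `-γ`, and this is the adjoint of `R⁺`; moreover `R` intertwines `C` with its flip, which is
the adjoint of `C`. The fusion identity `(Δ ⊗ id) R = R₁₃ R₂₃`, an instance of the addition theorem
of the q-exponential, gives the Yang–Baxter equation, hence b), and shows that `C₁₂` commutes with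
`R₁₃ R₂₃`. In `η_N` the R-matrix of the bond `n, n + 1` occurs once, and the other factors that
touch the bond can be grouped into pairs, each commuting with the Casimir operator of the bond or
with its flip. So `η_N` intertwines the two.
-/

namespace SpinChain

noncomputable section

/-! ### q-numbers -/

section QNumbers

theorem qPow_add (γ x y : ℝ) : qPow γ (x + y) = qPow γ x * qPow γ y := by
  simp only [qPow, ← Complex.exp_add]
  congr 1
  push_cast
  ring

@[simp] theorem qPow_zero (γ : ℝ) : qPow γ 0 = 1 := by simp [qPow]

theorem qPow_neg_left (γ x : ℝ) : qPow (-γ) x = qPow γ (-x) := by simp [qPow]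

theorem star_qPow (γ x : ℝ) : star (qPow γ x) = qPow (-γ) x := by
  simp only [qPow, Complex.star_def, ← Complex.exp_conj]
  simp

theorem qPow_mul_qPow_neg (γ x : ℝ) : qPow γ x * qPow γ (-x) = 1 := by
  rw [← qPow_add, add_neg_cancel, qPow_zero]

theorem qPow_pow (γ x : ℝ) (n : ℕ) : qPow γ x ^ n = qPow γ (x * n) := by
  simp only [qPow, ← Complex.exp_nat_mul]
  congr 1
  push_cast
  ring

theorem qPow_eq_cos_add_sin (γ x : ℝ) :
    qPow γ x = Real.cos (γ * x) + Real.sin (γ * x) * Complex.I := by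
  rw [qPow, show Complex.I * γ * x = ((γ * x : ℝ) : ℂ) * Complex.I by push_cast; ring,
    Complex.exp_mul_I, Complex.ofReal_cos, Complex.ofReal_sin]

theorem qPow_neg_eq_cos_sub_sin (γ x : ℝ) :
    qPow γ (-x) = Real.cos (γ * x) - Real.sin (γ * x) * Complex.I := by
  rw [qPow_eq_cos_add_sin, mul_neg, Real.cos_neg, Real.sin_neg]
  push_cast
  ring

@[simp] theorem qNum_zero (γ : ℝ) : qNum γ 0 = 0 := by simp [qNum]

theorem qNum_neg (γ x : ℝ) : qNum γ (-x) = -qNum γ x := by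
  unfold qNum
  split_ifs <;> simp [neg_div]

@[simp] theorem qNum_neg_left (γ x : ℝ) : qNum (-γ) x = qNum γ x := by simp [qNum]

theorem qNum_one {γ : ℝ} (h1 : qNum γ 1 ≠ 0) : qNum γ 1 = 1 := by
  by_cases h0 : γ = 0
  · simp [qNum, h0]
  · rw [qNum, if_neg h0, mul_one] at h1 ⊢
    exact div_self (div_ne_zero_iff.1 h1).2

theorem qNum_add (γ x y : ℝ) :
    (qNum γ (x + y) : ℂ) = qPow γ (-y) * qNum γ x + qPow γ x * qNum γ y := by
  by_cases h : γ = 0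
  · simp [h, qNum, qPow]
  · simp only [qNum, h, if_false, qPow_eq_cos_add_sin γ x, qPow_neg_eq_cos_sub_sin, mul_add,
      Real.sin_add]
    push_cast
    ring

theorem qNum_add_one_mul_qPow {γ : ℝ} (h1 : qNum γ 1 ≠ 0) (x : ℝ) :
    (qNum γ (x + 1) : ℂ) * qPow γ x = qNum γ x * qPow γ (x - 1) + qPow γ (2 * x) := by
  rw [qNum_add, qNum_one h1, sub_eq_add_neg, qPow_add γ x (-1), two_mul, qPow_add γ x x,
    Complex.ofReal_one]
  ring

/-- The coefficient `q - q⁻¹` of the universal R-matrix. -/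
def qDiff (γ : ℝ) : ℂ := qPow γ 1 - qPow γ (-1)

theorem qDiff_neg (γ : ℝ) : qDiff (-γ) = -qDiff γ := by simp [qDiff, qPow_neg_left]

theorem star_qDiff (γ : ℝ) : star (qDiff γ) = qDiff (-γ) := by
  simp only [qDiff, star_sub, star_qPow]

theorem qDiff_mul_qNum {γ : ℝ} (h1 : qNum γ 1 ≠ 0) (x : ℝ) :
    qDiff γ * qNum γ x = qPow γ x - qPow γ (-x) := by
  by_cases h0 : γ = 0
  · simp [h0, qDiff, qPow]
  · have hs : (Real.sin γ : ℂ) ≠ 0 := by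
      rw [qNum, if_neg h0] at h1
      exact_mod_cast (div_ne_zero_iff.1 h1).2
    rw [qDiff, qPow_neg_eq_cos_sub_sin γ 1, qPow_neg_eq_cos_sub_sin γ x, qPow_eq_cos_add_sin γ 1,
      qPow_eq_cos_add_sin γ x, mul_one, qNum, if_neg h0, Complex.ofReal_div]
    field_simp
    ring

theorem qNum_sq_sub_sq (γ x y : ℝ) :
    qNum γ x ^ 2 - qNum γ y ^ 2 = qNum γ (x + y) * qNum γ (x - y) := by
  by_cases h : γ = 0
  · simp only [qNum, h, if_true]
    ring
  · simp only [qNum, h, if_false, mul_add, mul_sub, Real.sin_add, Real.sin_sub]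
    have hx := Real.sin_sq_add_cos_sq (γ * x)
    have hy := Real.sin_sq_add_cos_sq (γ * y)
    rw [div_pow, div_pow, ← sub_div, div_mul_div_comm, ← sq (Real.sin γ)]
    congr 1
    linear_combination -(Real.sin (γ * x)) ^ 2 * hy + (Real.sin (γ * y)) ^ 2 * hx

theorem qNum_mul_qNum_sub {γ : ℝ} (h1 : qNum γ 1 ≠ 0) (s k : ℝ) :
    qNum γ (s + k) * qNum γ (s - k + 1) - qNum γ (s - k) * qNum γ (s + k + 1) =
      qNum γ (2 * k) := by
  have hs := qNum_sq_sub_sq γ (s + 1 / 2) (k - 1 / 2)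
  have hs' := qNum_sq_sub_sq γ (s + 1 / 2) (k + 1 / 2)
  have hk := qNum_sq_sub_sq γ (k + 1 / 2) (k - 1 / 2)
  ring_nf at hs hs' hk ⊢
  rw [qNum_one h1] at hk
  linear_combination hs' - hs + hk

theorem qNum_pos {γ x : ℝ} (hγ : |γ| < Real.pi) (hx : 0 < x) (h : x * |γ| < Real.pi) :
    0 < qNum γ x := by
  have qNum_abs : qNum |γ| x = qNum γ x := by
    rcases abs_choice γ with h | h <;> simp [h]
  rw [← qNum_abs]
  rcases (abs_nonneg γ).eq_or_lt with h0 | h0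
  · simpa [qNum, ← h0] using hx
  · rw [qNum, if_neg h0.ne']
    exact div_pos (Real.sin_pos_of_pos_of_lt_pi (by positivity) (by linarith))
      (Real.sin_pos_of_pos_of_lt_pi h0 hγ)

variable {γ : ℝ} {d n : ℕ}

theorem qFactorial_succ (γ : ℝ) (n : ℕ) :
    qFactorial γ (n + 1) = qFactorial γ n * qNum γ ((n : ℝ) + 1) := by
  rw [qFactorial, Finset.prod_range_succ, ← qFactorial]

@[simp] theorem qFactorial_neg (γ : ℝ) (n : ℕ) : qFactorial (-γ) n = qFactorial γ n := by
  simp only [qFactorial, qNum_neg_left]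

theorem qNum_succ_ne_zero (hf : qFactorial γ d ≠ 0) (hn : n < d) : qNum γ ((n : ℝ) + 1) ≠ 0 :=
  Finset.prod_ne_zero_iff.1 hf n (Finset.mem_range.2 hn)

theorem qNum_natCast_ne_zero (hf : qFactorial γ d ≠ 0) (hn : n ≠ 0) (hnd : n ≤ d) :
    qNum γ n ≠ 0 := by
  obtain ⟨m, rfl⟩ := Nat.exists_eq_succ_of_ne_zero hn
  exact_mod_cast qNum_succ_ne_zero hf hnd

theorem qFactorial_ne_zero_of_le (hf : qFactorial γ d ≠ 0) (hn : n ≤ d) : qFactorial γ n ≠ 0 :=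
  Finset.prod_ne_zero_iff.2 fun _ hk =>
    qNum_succ_ne_zero hf ((Finset.mem_range.1 hk).trans_le hn)

theorem qFactorial_ne_zero_of_forall (h : ∀ m : ℕ, 1 ≤ m → m ≤ n → qNum γ m ≠ 0) :
    qFactorial γ n ≠ 0 :=
  Finset.prod_ne_zero_iff.2 fun k hk => by
    exact_mod_cast h (k + 1) (by omega) (Finset.mem_range.1 hk)

end QNumbers

/-! ### Truncated q-exponentials -/

section Exponential

open Finset (range)
open Finset.HasAntidiagonal (antidiagonal mem_antidiagonal)

/-- The coefficient `q ^ (n (n - 1) / 2) / [n]!` of the q-exponential series. -/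
def expCoeff (γ : ℝ) (n : ℕ) : ℂ := qPow γ ((n : ℝ) * ((n : ℝ) - 1) / 2) / (qFactorial γ n : ℂ)

@[simp] theorem expCoeff_zero (γ : ℝ) : expCoeff γ 0 = 1 := by simp [expCoeff, qFactorial]

theorem expCoeff_succ_mul {γ : ℝ} {n : ℕ} (h : qNum γ ((n : ℝ) + 1) ≠ 0) :
    expCoeff γ (n + 1) * qNum γ ((n : ℝ) + 1) = qPow γ n * expCoeff γ n := by
  have h : (qNum γ ((n : ℝ) + 1) : ℂ) ≠ 0 := by exact_mod_cast h
  have exponent_succ :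
      ((n + 1 : ℕ) : ℝ) * (((n + 1 : ℕ) : ℝ) - 1) / 2 = n + (n : ℝ) * ((n : ℝ) - 1) / 2 := by
    push_cast
    ring
  rw [expCoeff, qFactorial_succ, Complex.ofReal_mul, exponent_succ, qPow_add, div_mul_eq_mul_div,
    mul_div_mul_right _ _ h, mul_div_assoc, expCoeff]

theorem star_expCoeff (γ : ℝ) (n : ℕ) : star (expCoeff γ n) = expCoeff (-γ) n := by
  simp only [expCoeff, star_div₀, star_qPow, qFactorial_neg, Complex.star_def, Complex.conj_ofReal]

theorem qNum_smul_sum_antidiagonal_succ {M : Type*} [AddCommGroup M] [Module ℂ M] (γ : ℝ) (n : ℕ)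
    (f : ℕ → ℕ → M) :
    (qNum γ ((n : ℝ) + 1) : ℂ) • ∑ p ∈ antidiagonal (n + 1), f p.1 p.2 =
      ∑ p ∈ antidiagonal n, ((qPow γ (-p.2) * qNum γ ((p.1 : ℝ) + 1)) • f (p.1 + 1) p.2 +
        (qPow γ p.1 * qNum γ ((p.2 : ℝ) + 1)) • f p.1 (p.2 + 1)) := by
  have split_qNum : ∀ p ∈ antidiagonal (n + 1), (qNum γ ((n : ℝ) + 1) : ℂ) • f p.1 p.2 =
      (qPow γ (-p.2) * qNum γ p.1) • f p.1 p.2 + (qPow γ p.1 * qNum γ p.2) • f p.1 p.2 := by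
    intro p hp
    have hp : (n : ℝ) + 1 = p.1 + p.2 := by exact_mod_cast (mem_antidiagonal.1 hp).symm
    rw [hp, qNum_add, add_smul]
  rw [Finset.smul_sum, Finset.sum_congr rfl split_qNum, Finset.sum_add_distrib,
    Finset.Nat.sum_antidiagonal_succ, Finset.Nat.sum_antidiagonal_succ', Finset.sum_add_distrib]
  simp

theorem sum_range_sum_range_eq_sum_antidiagonal {M : Type*} [AddCommMonoid M] (d : ℕ)
    (f : ℕ → ℕ → M) (h : ∀ k l, d < k + l → f k l = 0) :
    ∑ k ∈ range (d + 1), ∑ l ∈ range (d + 1), f k l =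
      ∑ n ∈ range (d + 1), ∑ p ∈ antidiagonal n, f p.1 p.2 := by
  rw [← Finset.sum_product' (f := f),
    ← Finset.sum_filter_of_ne (p := fun p : ℕ × ℕ => p.1 + p.2 ≤ d)
      (fun p _ hp => not_lt.1 fun hlt => hp (h _ _ hlt)),
    ← Finset.sum_fiberwise_of_maps_to (g := fun p : ℕ × ℕ => p.1 + p.2)
      (t := range (d + 1)) (by simp)]
  refine Finset.sum_congr rfl fun n hn => Finset.sum_congr ?_ fun _ _ => rfl
  ext p
  simp only [Finset.mem_range] at hn
  simp only [Finset.mem_filter, Finset.mem_product, Finset.mem_range, mem_antidiagonal]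
  omega

variable {A : Type*} [Ring A] [Algebra ℂ A] {γ : ℝ} {d : ℕ}

/-- The q-exponential `∑ n ≤ d, q ^ (n (n - 1) / 2) / [n]! • y ^ n`, truncated after the degree
`d`; on the spin `d / 2` module the later terms vanish. -/
def qExp (γ : ℝ) (d : ℕ) (y : A) : A := ∑ n ∈ range (d + 1), expCoeff γ n • y ^ n

theorem map_qExp {B : Type*} [Ring B] [Algebra ℂ B] (f : A →ₐ[ℂ] B) (γ : ℝ) (d : ℕ) (y : A) :
    f (qExp γ d y) = qExp γ d (f y) := by
  simp only [qExp, map_sum, map_smul, map_pow]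

theorem semiconjBy_qExp {s x y : A} (h : SemiconjBy s x y) (γ : ℝ) (d : ℕ) :
    SemiconjBy s (qExp γ d x) (qExp γ d y) := by
  simp only [SemiconjBy, qExp, Finset.mul_sum, Finset.sum_mul]
  exact Finset.sum_congr rfl fun n _ => ((h.pow_right n).smul_right _).eq

theorem qExp_mul_qExp_eq_sum_antidiagonal (γ γ' : ℝ) {u v : A}
    (h : ∀ k l, d < k + l → u ^ k * v ^ l = 0) :
    qExp γ d u * qExp γ' d v =
      ∑ n ∈ range (d + 1), ∑ p ∈ antidiagonal n,
        (expCoeff γ p.1 * expCoeff γ' p.2) • (u ^ p.1 * v ^ p.2) := by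
  rw [← sum_range_sum_range_eq_sum_antidiagonal d
    (fun k l => (expCoeff γ k * expCoeff γ' l) • (u ^ k * v ^ l))
    fun k l hkl => by rw [h k l hkl, smul_zero]]
  simp only [qExp, Finset.sum_mul_sum, smul_mul_smul_comm]

theorem sum_antidiagonal_expCoeff_mul_expCoeff_neg (hf : qFactorial γ d ≠ 0) {n : ℕ}
    (hn : n < d) :
    ∑ p ∈ antidiagonal (n + 1), expCoeff γ p.1 * ((-1) ^ p.2 * expCoeff (-γ) p.2) = 0 := by
  have hn0 : (qNum γ ((n : ℝ) + 1) : ℂ) ≠ 0 := by exact_mod_cast qNum_succ_ne_zero hf hn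
  refine (smul_eq_zero_iff_right hn0).1 ?_
  rw [qNum_smul_sum_antidiagonal_succ γ n
    fun k l => expCoeff γ k * ((-1) ^ l * expCoeff (-γ) l)]
  refine Finset.sum_eq_zero fun p hp => ?_
  have hp := mem_antidiagonal.1 hp
  have recursion_left := expCoeff_succ_mul (qNum_succ_ne_zero hf (n := p.1) (by omega))
  have recursion_right :=
    expCoeff_succ_mul (γ := -γ) (qNum_succ_ne_zero (by simpa using hf) (n := p.2) (by omega))
  rw [qNum_neg_left, qPow_neg_left] at recursion_right
  simp only [smul_eq_mul, pow_succ]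
  linear_combination qPow γ (-p.2) * (-1) ^ p.2 * expCoeff (-γ) p.2 * recursion_left -
    qPow γ p.1 * expCoeff γ p.1 * (-1) ^ p.2 * recursion_right

theorem qExp_mul_qExp_neg (hf : qFactorial γ d ≠ 0) {y : A} (hy : y ^ (d + 1) = 0) :
    qExp γ d y * qExp (-γ) d (-y) = 1 := by
  have product_eq_zero (k l : ℕ) (hkl : d < k + l) : y ^ k * (-y) ^ l = 0 := by
    rw [neg_pow, ← mul_assoc, (Commute.neg_one_right (y ^ k)).pow_right l |>.eq, mul_assoc,
      ← pow_add, pow_eq_zero_of_le hkl hy, mul_zero]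
  rw [qExp_mul_qExp_eq_sum_antidiagonal _ _ product_eq_zero, Finset.sum_range_succ',
    Finset.sum_eq_zero]
  · simp
  · intro n hn
    have collect_pow : ∀ p ∈ antidiagonal (n + 1),
        (expCoeff γ p.1 * expCoeff (-γ) p.2) • (y ^ p.1 * (-y) ^ p.2) =
        (expCoeff γ p.1 * ((-1) ^ p.2 * expCoeff (-γ) p.2)) • y ^ (n + 1) := by
      intro p hp
      rw [← mem_antidiagonal.1 hp, pow_add, ← neg_one_smul ℂ y, smul_pow, mul_smul_comm, smul_smul]
      congr 1
      ring
    rw [Finset.sum_congr rfl collect_pow, ← Finset.sum_smul,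
      sum_antidiagonal_expCoeff_mul_expCoeff_neg hf (Finset.mem_range.1 hn), zero_smul]

theorem mul_pow_of_mul_eq_smul {x y : A} {c : ℂ} (h : x * y = c • (y * x)) (n : ℕ) :
    x * y ^ n = c ^ n • (y ^ n * x) := by
  induction n with
  | zero => simp
  | succ n ih =>
    rw [pow_succ, ← mul_assoc, ih, smul_mul_assoc, mul_assoc, h, mul_smul_comm, smul_smul,
      pow_succ, mul_assoc]

theorem pow_mul_of_mul_eq_smul {x y : A} {c : ℂ} (h : x * y = c • (y * x)) (n : ℕ) :
    x ^ n * y = c ^ n • (y * x ^ n) := by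
  induction n with
  | zero => simp
  | succ n ih =>
    rw [pow_succ', mul_assoc, ih, mul_smul_comm, ← mul_assoc, h, smul_mul_assoc, smul_smul,
      mul_assoc, pow_succ]

-- The q-binomial theorem, with the q-binomial coefficients written as quotients of `expCoeff`.
theorem expCoeff_smul_add_pow (hf : qFactorial γ d ≠ 0) {u v : A}
    (huv : v * u = qPow γ (-2) • (u * v)) {n : ℕ} (hn : n ≤ d) :
    expCoeff γ n • (u + v) ^ n =
      ∑ p ∈ antidiagonal n, (expCoeff γ p.1 * expCoeff γ p.2) • (u ^ p.1 * v ^ p.2) := by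
  induction n with
  | zero => simp
  | succ n ih =>
    have hn0 : qNum γ ((n : ℝ) + 1) ≠ 0 := qNum_succ_ne_zero hf hn
    refine smul_right_injective A (r := (qNum γ ((n : ℝ) + 1) : ℂ)) (by exact_mod_cast hn0) ?_
    simp only
    rw [qNum_smul_sum_antidiagonal_succ γ n
        fun k l => (expCoeff γ k * expCoeff γ l) • (u ^ k * v ^ l),
      smul_smul, mul_comm, expCoeff_succ_mul hn0, mul_smul, pow_succ, ← smul_mul_assoc,
      ih (by omega), Finset.sum_mul, Finset.smul_sum]
    refine Finset.sum_congr rfl fun p hp => ?_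
    have hp := mem_antidiagonal.1 hp
    have recursion_left := expCoeff_succ_mul (qNum_succ_ne_zero hf (n := p.1) (by omega))
    have recursion_right := expCoeff_succ_mul (qNum_succ_ne_zero hf (n := p.2) (by omega))
    have append_u : u ^ p.1 * v ^ p.2 * u = qPow γ (-2 * p.2) • (u ^ (p.1 + 1) * v ^ p.2) := by
      rw [mul_assoc, pow_mul_of_mul_eq_smul huv, qPow_pow, mul_smul_comm, ← mul_assoc, ← pow_succ]
    have append_v : u ^ p.1 * v ^ p.2 * v = u ^ p.1 * v ^ (p.2 + 1) := by
      rw [mul_assoc, ← pow_succ]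
    have qPow_n : qPow γ n = qPow γ p.1 * qPow γ p.2 := by
      rw [← qPow_add, ← hp, Nat.cast_add]
    have qPow_neg_two : qPow γ p.2 * qPow γ (-2 * p.2) = qPow γ (-p.2) := by
      rw [← qPow_add]
      ring_nf
    rw [mul_add, smul_mul_assoc, smul_mul_assoc, append_u, append_v, smul_add]
    simp only [smul_smul]
    congr 2
    · rw [qPow_n]
      linear_combination qPow γ p.1 * expCoeff γ p.1 * expCoeff γ p.2 * qPow_neg_two -
        qPow γ (-p.2) * expCoeff γ p.2 * recursion_left
    · rw [qPow_n]
      linear_combination -(qPow γ p.1 * expCoeff γ p.1 * recursion_right)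

theorem qExp_mul_qExp (hf : qFactorial γ d ≠ 0) {u v : A} (huv : v * u = qPow γ (-2) • (u * v))
    (h0 : ∀ k l, d < k + l → u ^ k * v ^ l = 0) :
    qExp γ d u * qExp γ d v = qExp γ d (u + v) := by
  rw [qExp_mul_qExp_eq_sum_antidiagonal _ _ h0]
  exact Finset.sum_congr rfl fun n hn =>
    (expCoeff_smul_add_pow hf huv (Nat.lt_succ_iff.1 (Finset.mem_range.1 hn))).symm

section Intertwining

variable {E F G k k' : A} {c : ℂ}

-- With `k = K²`, `k' = K⁻²` and `c = q - q⁻¹` this is the commutator of `E ^ (n + 1)` and `F`.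
theorem smul_commutator_pow (h1 : qNum γ 1 ≠ 0)
    (hk : k * E = qPow γ 2 • (E * k)) (hk' : k' * E = qPow γ (-2) • (E * k'))
    (hEF : c • (E * F - F * E) = k - k') (n : ℕ) :
    c • (E ^ (n + 1) * F - F * E ^ (n + 1)) =
      (qNum γ ((n : ℝ) + 1) : ℂ) • (E ^ n * (qPow γ n • k - qPow γ (-n) • k')) := by
  induction n with
  | zero => simp [qNum_one h1, hEF]
  | succ n ih =>
    have leibniz : E ^ (n + 1 + 1) * F - F * E ^ (n + 1 + 1) =
        E * (E ^ (n + 1) * F - F * E ^ (n + 1)) + (E * F - F * E) * E ^ (n + 1) := by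
      rw [pow_succ' E (n + 1)]
      noncomm_ring
    have coeff_k := qNum_add_one_mul_qPow h1 ((n : ℝ) + 1)
    have coeff_k' := qNum_add_one_mul_qPow (γ := -γ) (by simpa using h1) ((n : ℝ) + 1)
    simp only [qNum_neg_left, qPow_neg_left, add_sub_cancel_right, ← neg_mul] at coeff_k coeff_k'
    rw [leibniz, smul_add, ← mul_smul_comm, ih, ← smul_mul_assoc c, hEF, sub_mul,
      mul_pow_of_mul_eq_smul hk, mul_pow_of_mul_eq_smul hk', qPow_pow, qPow_pow, mul_smul_comm,
      ← mul_assoc, ← pow_succ', mul_sub, mul_sub]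
    simp only [mul_smul_comm, smul_sub, smul_smul]
    push_cast
    rw [coeff_k, coeff_k', add_smul, add_smul]
    abel

theorem smul_mul_pow (hGE : Commute G E) (n : ℕ) : (c • (G * E)) ^ n = c ^ n • (G ^ n * E ^ n) := by
  rw [smul_pow, hGE.mul_pow]

theorem qExp_commutator_eq_sum (hGE : Commute G E) (hGF : Commute G F) :
    qExp γ d (c • (G * E)) * F - F * qExp γ d (c • (G * E)) =
      ∑ n ∈ range (d + 1), expCoeff γ n • c ^ n • (G ^ n * (E ^ n * F - F * E ^ n)) := by
  rw [qExp, Finset.sum_mul, Finset.mul_sum, ← Finset.sum_sub_distrib]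
  refine Finset.sum_congr rfl fun n _ => ?_
  rw [smul_mul_pow hGE, smul_mul_assoc, smul_mul_assoc, mul_smul_comm, mul_smul_comm, ← smul_sub,
    ← smul_sub, mul_sub, mul_assoc, ← mul_assoc F, ← (hGF.pow_left n).eq, mul_assoc]

theorem mul_qExp_sub_qExp_mul_eq_sum (hGE : Commute G E) (hGk : Commute G k)
    (hk : k * E = qPow γ 2 • (E * k)) :
    G * k * qExp γ d (c • (G * E)) - qExp γ d (c • (G * E)) * (G * k') =
      ∑ n ∈ range (d + 1),
        expCoeff γ n • c ^ n • (G ^ (n + 1) * (E ^ n * (qPow γ (2 * n) • k - k'))) := by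
  rw [qExp, Finset.sum_mul, Finset.mul_sum, ← Finset.sum_sub_distrib]
  refine Finset.sum_congr rfl fun n _ => ?_
  have move_k : G * k * (G ^ n * E ^ n) = G ^ (n + 1) * (E ^ n * (qPow γ (2 * n) • k)) := by
    rw [mul_assoc, ← mul_assoc k, ← (hGk.pow_left n).eq, mul_assoc (G ^ n),
      mul_pow_of_mul_eq_smul hk, qPow_pow, ← mul_assoc, ← pow_succ', mul_smul_comm, mul_smul_comm,
      mul_smul_comm]
  have move_G : G ^ n * E ^ n * (G * k') = G ^ (n + 1) * (E ^ n * k') := by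
    rw [mul_assoc, ← mul_assoc (E ^ n), ← (hGE.pow_right n).eq, mul_assoc G, ← mul_assoc,
      ← pow_succ]
  rw [smul_mul_pow hGE, smul_mul_assoc, smul_mul_assoc, mul_smul_comm, mul_smul_comm, ← smul_sub,
    ← smul_sub, mul_sub, mul_sub, move_k, move_G]

-- The intertwining property of the R-matrix, freed of the factors `q ^ (H ⊗ H)`: `G` stands for
-- `F ⊗ 1`, and `E`, `F`, `k`, `k'` for `1 ⊗ E`, `1 ⊗ F`, `1 ⊗ K²`, `1 ⊗ K⁻²`.
theorem qExp_mul_add (h1 : qNum γ 1 ≠ 0) (hf : qFactorial γ d ≠ 0)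
    (hGE : Commute G E) (hGF : Commute G F) (hGk : Commute G k)
    (hk : k * E = qPow γ 2 • (E * k)) (hk' : k' * E = qPow γ (-2) • (E * k'))
    (hEF : c • (E * F - F * E) = k - k') (hG : G ^ (d + 1) = 0) :
    SemiconjBy (qExp γ d (c • (G * E))) (G * k' + F) (F + G * k) := by
  suffices h : qExp γ d (c • (G * E)) * F - F * qExp γ d (c • (G * E)) =
      G * k * qExp γ d (c • (G * E)) - qExp γ d (c • (G * E)) * (G * k') by
    rw [SemiconjBy, mul_add, add_mul, add_comm, sub_eq_sub_iff_add_eq_add.1 h, add_comm]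
  rw [qExp_commutator_eq_sum hGE hGF, mul_qExp_sub_qExp_mul_eq_sum hGE hGk hk,
    Finset.sum_range_succ', Finset.sum_range_succ _ d, hG]
  simp only [pow_zero, one_mul, mul_one, sub_self, smul_zero, add_zero, zero_mul]
  refine Finset.sum_congr rfl fun n hn => ?_
  have pull_qPow : qPow γ n • (qPow γ n • k - qPow γ (-n) • k') = qPow γ (2 * n) • k - k' := by
    rw [smul_sub, smul_smul, smul_smul, ← qPow_add, qPow_mul_qPow_neg, one_smul, two_mul]
  rw [pow_succ c, mul_smul, ← mul_smul_comm, smul_commutator_pow h1 hk hk' hEF, mul_smul_comm,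
    smul_comm (c ^ n), smul_smul,
    expCoeff_succ_mul (qNum_succ_ne_zero hf (Finset.mem_range.1 hn)), mul_comm, mul_smul,
    ← pull_qPow, mul_smul_comm, mul_smul_comm, smul_comm (qPow γ n) (c ^ n)]

end Intertwining

end Exponential

/-! ### The spin module -/

section OneSite

variable {γ : ℝ} {d : ℕ}

/-- Unitarity of the spin `d / 2` module: the square roots in the matrix elements of `E` and `F`
are taken of positive numbers, so that `F` is the adjoint of `E`. -/
def IsUnitary (γ : ℝ) (d : ℕ) : Prop :=
  ∀ n : ℕ, n < d → 0 < qNum γ ((d : ℝ) - n) * qNum γ ((n : ℝ) + 1)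

theorem isUnitary_of_mul_abs_lt_pi (hγ : |γ| < Real.pi) (h : (d : ℝ) * |γ| < Real.pi) :
    IsUnitary γ d := by
  intro n hn
  have hn' : (n : ℝ) + 1 ≤ d := by exact_mod_cast hn
  have hpos : ∀ x : ℝ, 0 < x → x ≤ d → 0 < qNum γ x := fun x hx hxd =>
    qNum_pos hγ hx ((mul_le_mul_of_nonneg_right hxd (abs_nonneg γ)).trans_lt h)
  exact mul_pos (hpos _ (by linarith) (by linarith [Nat.cast_nonneg (α := ℝ) n]))
    (hpos _ (by positivity) hn')

theorem IsUnitary.qFactorial_ne_zero (hu : IsUnitary γ d) : qFactorial γ d ≠ 0 :=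
  Finset.prod_ne_zero_iff.2 fun n hn => right_ne_zero_of_mul (hu n (Finset.mem_range.1 hn)).ne'

theorem IsUnitary.qNum_one_ne_zero (hu : IsUnitary γ d) (hd : d ≠ 0) : qNum γ 1 ≠ 0 := by
  simpa using right_ne_zero_of_mul (hu 0 hd.bot_lt).ne'

theorem IsUnitary.neg (hu : IsUnitary γ d) : IsUnitary (-γ) d := fun n hn => by
  simpa only [qNum_neg_left] using hu n hn

/-- The matrix element `√([d - n] [n + 1])` of `E` and `F` between the basis vectors with indices
`n` and `n + 1`. -/
def ladder (γ : ℝ) (d n : ℕ) : ℂ :=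
  Complex.sqrt ((qNum γ ((d : ℝ) - n) * qNum γ ((n : ℝ) + 1) : ℝ))

theorem ladder_mul_self (γ : ℝ) (d n : ℕ) : ladder γ d n * ladder γ d n =
    ((qNum γ ((d : ℝ) - n) * qNum γ ((n : ℝ) + 1) : ℝ) : ℂ) := by
  rw [ladder, Complex.sqrt, ← sq]
  exact_mod_cast Complex.cpow_nat_inv_pow _ two_ne_zero

theorem ladder_self (γ : ℝ) (d : ℕ) : ladder γ d d = 0 := by
  rw [← mul_self_eq_zero, ladder_mul_self, sub_self, qNum_zero, zero_mul, Complex.ofReal_zero]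

theorem ladder_ne_zero (hf : qFactorial γ d ≠ 0) {n : ℕ} (hn : n < d) : ladder γ d n ≠ 0 := by
  have hdn : qNum γ ((d : ℝ) - n) ≠ 0 := by
    rw [← Nat.cast_sub hn.le]
    exact qNum_natCast_ne_zero hf (Nat.sub_ne_zero_of_lt hn) (Nat.sub_le d n)
  rw [← mul_self_ne_zero, ladder_mul_self]
  exact_mod_cast mul_ne_zero hdn (qNum_succ_ne_zero hf hn)

theorem IsUnitary.star_ladder (hu : IsUnitary γ d) {n : ℕ} (hn : n < d) :
    star (ladder γ d n) = ladder γ d n := by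
  rw [ladder, Complex.sqrt_of_nonneg (by exact_mod_cast (hu n hn).le)]
  exact Complex.conj_ofReal _

theorem spinE_apply (i j : Fin (d + 1)) :
    spinE γ d i j = if (i : ℕ) = (j : ℕ) + 1 then ladder γ d j else 0 := by
  unfold spinE ladder weight
  congr 5 <;> ring

theorem spinF_apply (i j : Fin (d + 1)) :
    spinF γ d i j = if (i : ℕ) + 1 = (j : ℕ) then ladder γ d i else 0 := by
  unfold spinF ladder weight
  split_ifs with h
  · have h : (j : ℝ) = i + 1 := by exact_mod_cast h.symm
    rw [mul_comm, h]
    congr 4 <;> ring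
  · rfl

theorem transpose_spinF : (spinF γ d)ᵀ = spinE γ d := by
  ext i j
  rw [Matrix.transpose_apply, spinE_apply, spinF_apply]
  simp only [eq_comm]

theorem transpose_spinE : (spinE γ d)ᵀ = spinF γ d := by
  rw [← transpose_spinF, Matrix.transpose_transpose]

theorem IsUnitary.conjTranspose_spinF (hu : IsUnitary γ d) : (spinF γ d)ᴴ = spinE γ d := by
  ext i j
  rw [Matrix.conjTranspose_apply, spinE_apply, spinF_apply]
  by_cases h : (i : ℕ) = j + 1
  · rw [if_pos h, if_pos h.symm, hu.star_ladder (by omega)]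
  · rw [if_neg h, if_neg (Ne.symm h), star_zero]

theorem IsUnitary.conjTranspose_spinE (hu : IsUnitary γ d) : (spinE γ d)ᴴ = spinF γ d := by
  rw [← hu.conjTranspose_spinF, Matrix.conjTranspose_conjTranspose]

theorem spinE_neg : spinE (-γ) d = spinE γ d := by
  ext i j
  simp only [spinE, qNum_neg_left]

theorem spinF_neg : spinF (-γ) d = spinF γ d := by
  rw [← transpose_spinE, spinE_neg, transpose_spinE]

theorem spinK_neg : spinK (-γ) d = spinKInv γ d := by
  simp only [spinK, spinKInv, qPow_neg_left]

theorem spinKInv_neg : spinKInv (-γ) d = spinK γ d := by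
  rw [← spinK_neg, neg_neg]

theorem transpose_spinK : (spinK γ d)ᵀ = spinK γ d := Matrix.diagonal_transpose _

theorem transpose_spinKInv : (spinKInv γ d)ᵀ = spinKInv γ d := Matrix.diagonal_transpose _

theorem conjTranspose_spinK : (spinK γ d)ᴴ = spinKInv γ d := by
  rw [spinK, Matrix.diagonal_conjTranspose, ← spinK_neg]
  exact congrArg Matrix.diagonal (funext fun i => star_qPow _ _)

theorem conjTranspose_spinKInv : (spinKInv γ d)ᴴ = spinK γ d := by
  rw [← conjTranspose_spinK, Matrix.conjTranspose_conjTranspose]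

theorem sum_spinF_mul (g : ℕ → ℂ) (i : Fin (d + 1)) :
    ∑ j : Fin (d + 1), spinF γ d i j * g j = ladder γ d i * g (i + 1) := by
  simp only [spinF_apply, ite_mul, zero_mul]
  rcases Nat.lt_or_ge ((i : ℕ) + 1) (d + 1) with h | h
  · rw [Finset.sum_eq_single_of_mem (⟨i + 1, h⟩ : Fin (d + 1)) (Finset.mem_univ _), if_pos rfl]
    exact fun j _ hj => if_neg fun hij => hj (Fin.ext hij.symm)
  · rw [show (i : ℕ) = d by omega, ladder_self, zero_mul]
    exact Finset.sum_eq_zero fun j _ => if_neg (by omega)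

theorem spinF_mul_spinE : spinF γ d * spinE γ d = Matrix.diagonal fun i : Fin (d + 1) =>
    ((qNum γ ((d : ℝ) - i) * qNum γ ((i : ℝ) + 1) : ℝ) : ℂ) := by
  ext i j
  simp only [Matrix.mul_apply, spinE_apply]
  rw [sum_spinF_mul (fun k => if k = (j : ℕ) + 1 then ladder γ d j else 0), Matrix.diagonal_apply]
  by_cases h : i = j
  · rw [h, if_pos rfl, if_pos rfl, ladder_mul_self]
  · rw [if_neg (fun h' => h (Fin.ext (Nat.succ_injective h'))), if_neg h, mul_zero]

theorem natCast_val_rev (i : Fin (d + 1)) : ((i.rev : ℕ) : ℝ) = d - i := by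
  rw [Fin.val_rev, Nat.add_sub_add_right, Nat.cast_sub i.is_le]

theorem submatrix_rev_spinF : (spinF γ d).submatrix Fin.revPerm Fin.revPerm = spinE γ d := by
  ext i j
  rw [Matrix.submatrix_apply, Fin.revPerm_apply, Fin.revPerm_apply, ← transpose_spinF,
    Matrix.transpose_apply, spinF_apply, spinF_apply, ladder, ladder, natCast_val_rev]
  simp only [Fin.val_rev, show d + 1 - (i + 1) + 1 = d + 1 - ((j : ℕ) + 1) ↔ (j : ℕ) + 1 = i by
    omega]
  split_ifs with h
  · have h : (i : ℝ) = j + 1 := by exact_mod_cast h.symm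
    rw [h, mul_comm]
    congr 4 <;> ring
  · rfl

theorem spinE_mul_spinF : spinE γ d * spinF γ d = Matrix.diagonal fun i : Fin (d + 1) =>
    ((qNum γ i * qNum γ ((d : ℝ) - i + 1) : ℝ) : ℂ) := by
  have hE : (spinE γ d).submatrix Fin.revPerm Fin.revPerm = spinF γ d := by
    rw [← submatrix_rev_spinF, Matrix.submatrix_submatrix]
    exact Matrix.ext fun i j => by simp
  calc spinE γ d * spinF γ d
      = (spinF γ d * spinE γ d).submatrix Fin.revPerm Fin.revPerm := by
        rw [← Matrix.submatrix_mul_equiv _ _ _ Fin.revPerm, submatrix_rev_spinF, hE]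
    _ = _ := by
        rw [spinF_mul_spinE, Matrix.submatrix_diagonal_equiv]
        congr 1
        ext i
        simp only [Function.comp_apply, Fin.revPerm_apply, natCast_val_rev, sub_sub_cancel]

theorem spin_commutator (h1 : qNum γ 1 ≠ 0) :
    spinE γ d * spinF γ d - spinF γ d * spinE γ d =
      Matrix.diagonal fun i : Fin (d + 1) => (qNum γ (2 * weight d i) : ℂ) := by
  rw [spinE_mul_spinF, spinF_mul_spinE, Matrix.diagonal_sub]
  congr 1
  ext i
  have h := qNum_mul_qNum_sub h1 ((d : ℝ) / 2) (weight d i)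
  rw [← h, ← Complex.ofReal_sub, weight]
  congr 4 <;> ring_nf

theorem qDiff_smul_spin_commutator (h1 : qNum γ 1 ≠ 0) :
    qDiff γ • (spinE γ d * spinF γ d - spinF γ d * spinE γ d) =
      spinK γ d * spinK γ d - spinKInv γ d * spinKInv γ d := by
  rw [spin_commutator h1, spinK, spinKInv, Matrix.diagonal_mul_diagonal,
    Matrix.diagonal_mul_diagonal, Matrix.diagonal_sub, ← Matrix.diagonal_smul]
  congr 1
  ext i
  simp only [Pi.smul_apply, smul_eq_mul, qDiff_mul_qNum h1, ← qPow_add]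
  ring_nf

theorem val_eq_of_spinE_pow_apply_ne_zero {n : ℕ} {i j : Fin (d + 1)}
    (h : (spinE γ d ^ n) i j ≠ 0) : (i : ℕ) = j + n := by
  induction n generalizing j with
  | zero =>
    by_contra hij
    exact h (Matrix.one_apply_ne fun e => hij (congrArg Fin.val e))
  | succ n ih =>
    rw [pow_succ, Matrix.mul_apply] at h
    obtain ⟨k, _, hk⟩ := Finset.exists_ne_zero_of_sum_ne_zero h
    have hik := ih (left_ne_zero_of_mul hk)
    have hkj := right_ne_zero_of_mul hk
    rw [spinE_apply] at hkj
    have := (ite_ne_right_iff.1 hkj).1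
    omega

theorem spinE_pow_eq_zero {n : ℕ} (hn : d < n) : spinE γ d ^ n = 0 := by
  ext i j
  by_contra h
  have := val_eq_of_spinE_pow_apply_ne_zero h
  omega

theorem spinF_pow_eq_zero {n : ℕ} (hn : d < n) : spinF γ d ^ n = 0 := by
  rw [← transpose_spinE, ← Matrix.transpose_pow, spinE_pow_eq_zero hn, Matrix.transpose_zero]

theorem weight_of_eq_add_one {i j : Fin (d + 1)} (h : (i : ℕ) = j + 1) :
    weight d i = weight d j + 1 := by
  simp only [weight, h]
  push_cast
  ring

theorem diagonal_mul_spinE {f g : Fin (d + 1) → ℂ} {c : ℂ}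
    (h : ∀ i j : Fin (d + 1), (i : ℕ) = j + 1 → f i = c * g j) :
    Matrix.diagonal f * spinE γ d = c • (spinE γ d * Matrix.diagonal g) := by
  ext i j
  rw [Matrix.diagonal_mul, Matrix.smul_apply, Matrix.mul_diagonal, spinE_apply]
  split_ifs with hij
  · rw [h i j hij, smul_eq_mul]
    ring
  · simp

theorem spinK_mul_spinE : spinK γ d * spinE γ d = qPow γ 1 • (spinE γ d * spinK γ d) :=
  diagonal_mul_spinE fun i j hij => by rw [weight_of_eq_add_one hij, add_comm, qPow_add]

theorem spinF_mul_spinK : spinF γ d * spinK γ d = qPow γ 1 • (spinK γ d * spinF γ d) := by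
  have := congrArg Matrix.transpose (spinK_mul_spinE (γ := γ) (d := d))
  simpa only [Matrix.transpose_mul, Matrix.transpose_smul, transpose_spinE, transpose_spinK]
    using this

theorem spinKInv_mul_spinE :
    spinKInv γ d * spinE γ d = qPow γ (-1) • (spinE γ d * spinKInv γ d) := by
  simpa only [spinK_neg, spinE_neg, qPow_neg_left] using spinK_mul_spinE (γ := -γ) (d := d)

theorem spinF_mul_spinKInv :
    spinF γ d * spinKInv γ d = qPow γ (-1) • (spinKInv γ d * spinF γ d) := by
  simpa only [spinK_neg, spinF_neg, qPow_neg_left] using spinF_mul_spinK (γ := -γ) (d := d)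

end OneSite

/-! ### The R-matrix on two sites -/

section Kronecker

variable {m n : Type*}

theorem kronecker_sub {R : Type*} [Ring R] (A : Matrix m m R) (B B' : Matrix n n R) :
    A ⊗ₖ (B - B') = A ⊗ₖ B - A ⊗ₖ B' :=
  Matrix.ext fun _ _ => mul_sub _ _ _

theorem sub_kronecker {R : Type*} [Ring R] (A A' : Matrix m m R) (B : Matrix n n R) :
    (A - A') ⊗ₖ B = A ⊗ₖ B - A' ⊗ₖ B :=
  Matrix.ext fun _ _ => sub_mul _ _ _

theorem kronecker_pow {R : Type*} [CommSemiring R] [Fintype m] [DecidableEq m] [Fintype n]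
    [DecidableEq n] (A : Matrix m m R) (B : Matrix n n R) (k : ℕ) :
    (A ⊗ₖ B) ^ k = (A ^ k) ⊗ₖ (B ^ k) := by
  induction k with
  | zero => simp only [pow_zero, Matrix.one_kronecker_one]
  | succ k ih => rw [pow_succ, ih, ← Matrix.mul_kronecker_mul, pow_succ, pow_succ]

theorem transpose_qExp [Fintype m] [DecidableEq m] (γ : ℝ) (d : ℕ) (A : Matrix m m ℂ) :
    (qExp γ d A)ᵀ = qExp γ d Aᵀ := by
  simp only [qExp, Matrix.transpose_sum, Matrix.transpose_smul, Matrix.transpose_pow]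

theorem conjTranspose_qExp [Fintype m] [DecidableEq m] (γ : ℝ) (d : ℕ) (A : Matrix m m ℂ) :
    (qExp γ d A)ᴴ = qExp (-γ) d Aᴴ := by
  simp only [qExp, Matrix.conjTranspose_sum, Matrix.conjTranspose_smul, Matrix.conjTranspose_pow,
    star_expCoeff]

end Kronecker

section Swap

variable {d : ℕ}

/-- Conjugation by the flip of the two tensor factors, as an automorphism that exchanges the
two indices. -/
def swapConj (d : ℕ) : TwoSite d →ₐ[ℂ] TwoSite d :=
  (Matrix.reindexAlgEquiv ℂ ℂ (Equiv.prodComm (Fin (d + 1)) (Fin (d + 1)))).toAlgHom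

theorem swapConj_apply (A : TwoSite d) (x y) : swapConj d A x y = A x.swap y.swap := rfl

@[simp] theorem swapConj_swapConj (A : TwoSite d) : swapConj d (swapConj d A) = A := rfl

theorem swapConj_kronecker (A B : Matrix (Fin (d + 1)) (Fin (d + 1)) ℂ) :
    swapConj d (A ⊗ₖ B) = B ⊗ₖ A :=
  Matrix.ext fun _ _ => mul_comm _ _

theorem transpose_swapConj (A : TwoSite d) : (swapConj d A)ᵀ = swapConj d Aᵀ := rfl

theorem swapConj_diagonal (f : Fin (d + 1) × Fin (d + 1) → ℂ) :
    swapConj d (Matrix.diagonal f) = Matrix.diagonal fun x => f x.swap :=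
  Matrix.submatrix_diagonal_equiv f (Equiv.prodComm _ _)

theorem flip_mul_mul_flip (A : TwoSite d) : flip d * A * flip d = swapConj d A := by
  have h_flip : flip d = (1 : TwoSite d).submatrix (Equiv.refl _) (Equiv.prodComm _ _) := rfl
  rw [h_flip, Matrix.one_submatrix_mul, Matrix.mul_submatrix_one]
  rfl

end Swap

section TwoSites

variable {γ : ℝ} {d : ℕ}

theorem RPlus_eq (γ : ℝ) (d : ℕ) : RPlus γ d =
    qHH γ d * qExp γ d (qDiff γ • (spinF γ d ⊗ₖ spinE γ d)) * qHH γ d := rfl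

theorem transpose_qHH : (qHH γ d)ᵀ = qHH γ d := Matrix.diagonal_transpose _

theorem conjTranspose_qHH : (qHH γ d)ᴴ = qHH (-γ) d := by
  rw [qHH, Matrix.diagonal_conjTranspose]
  exact congrArg Matrix.diagonal (funext fun x => star_qPow _ _)

theorem swapConj_qHH : swapConj d (qHH γ d) = qHH γ d := by
  rw [qHH, swapConj_diagonal]
  simp only [Prod.fst_swap, Prod.snd_swap, mul_comm]

theorem qHH_mul_qHH_neg : qHH γ d * qHH (-γ) d = 1 := by
  rw [qHH, qHH, Matrix.diagonal_mul_diagonal]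
  simp only [qPow_neg_left, qPow_mul_qPow_neg, Matrix.diagonal_one]

theorem qHH_semiconj_diagonal_kronecker_spinE {g g' : Fin (d + 1) → ℂ}
    (h : ∀ i, qPow γ (weight d i) * g i = g' i) :
    SemiconjBy (qHH γ d) (Matrix.diagonal g ⊗ₖ spinE γ d) (Matrix.diagonal g' ⊗ₖ spinE γ d) := by
  ext ⟨i, k⟩ ⟨j, l⟩
  rw [qHH, Matrix.diagonal_mul, Matrix.mul_diagonal, Matrix.kronecker_apply,
    Matrix.kronecker_apply, Matrix.diagonal_apply, Matrix.diagonal_apply, spinE_apply]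
  split_ifs with hij hkl
  · subst hij
    rw [weight_of_eq_add_one hkl, mul_add, mul_one, qPow_add, ← h i]
    ring
  all_goals simp only [zero_mul, mul_zero]

theorem qHH_semiconj_diagonal_kronecker_spinF {g g' : Fin (d + 1) → ℂ}
    (h : ∀ i, qPow γ (weight d i) * g' i = g i) :
    SemiconjBy (qHH γ d) (Matrix.diagonal g ⊗ₖ spinF γ d) (Matrix.diagonal g' ⊗ₖ spinF γ d) := by
  have hE := congrArg Matrix.transpose (qHH_semiconj_diagonal_kronecker_spinE h).eq
  simp only [Matrix.transpose_mul, ← Matrix.kroneckerMap_transpose, Matrix.diagonal_transpose,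
    transpose_spinE, transpose_qHH] at hE
  exact hE.symm

theorem qHH_semiconj_spinF_kronecker_diagonal {g g' : Fin (d + 1) → ℂ}
    (h : ∀ i, qPow γ (weight d i) * g' i = g i) :
    SemiconjBy (qHH γ d) (spinF γ d ⊗ₖ Matrix.diagonal g) (spinF γ d ⊗ₖ Matrix.diagonal g') := by
  simpa only [swapConj_qHH, swapConj_kronecker] using
    (qHH_semiconj_diagonal_kronecker_spinF h).map (swapConj d)

theorem qHH_semiconj_one_kronecker_spinE :
    SemiconjBy (qHH γ d) (1 ⊗ₖ spinE γ d) (spinK γ d ⊗ₖ spinE γ d) := by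
  rw [← Matrix.diagonal_one]
  exact qHH_semiconj_diagonal_kronecker_spinE fun i => mul_one _

theorem qHH_semiconj_spinKInv_kronecker_spinE :
    SemiconjBy (qHH γ d) (spinKInv γ d ⊗ₖ spinE γ d) (1 ⊗ₖ spinE γ d) := by
  rw [← Matrix.diagonal_one]
  exact qHH_semiconj_diagonal_kronecker_spinE fun i => qPow_mul_qPow_neg _ _

theorem qHH_semiconj_spinK_kronecker_spinF :
    SemiconjBy (qHH γ d) (spinK γ d ⊗ₖ spinF γ d) (1 ⊗ₖ spinF γ d) := by
  rw [← Matrix.diagonal_one]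
  exact qHH_semiconj_diagonal_kronecker_spinF fun i => mul_one _

theorem qHH_semiconj_one_kronecker_spinF :
    SemiconjBy (qHH γ d) (1 ⊗ₖ spinF γ d) (spinKInv γ d ⊗ₖ spinF γ d) := by
  rw [← Matrix.diagonal_one]
  exact qHH_semiconj_diagonal_kronecker_spinF fun i => qPow_mul_qPow_neg _ _

theorem qHH_semiconj_spinF_kronecker_spinKInv :
    SemiconjBy (qHH γ d) (spinF γ d ⊗ₖ spinKInv γ d)
      (spinF γ d ⊗ₖ (spinKInv γ d * spinKInv γ d)) := by
  rw [spinKInv, Matrix.diagonal_mul_diagonal]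
  refine qHH_semiconj_spinF_kronecker_diagonal fun i => ?_
  rw [← mul_assoc, qPow_mul_qPow_neg, one_mul]

theorem qHH_semiconj_spinF_kronecker_spinK_mul_spinK :
    SemiconjBy (qHH γ d) (spinF γ d ⊗ₖ (spinK γ d * spinK γ d)) (spinF γ d ⊗ₖ spinK γ d) := by
  rw [spinK, Matrix.diagonal_mul_diagonal]
  exact qHH_semiconj_spinF_kronecker_diagonal fun i => rfl

theorem transpose_coF : (coF γ d)ᵀ = coE γ d := by
  rw [coF, coE, Matrix.transpose_add, ← Matrix.kroneckerMap_transpose,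
    ← Matrix.kroneckerMap_transpose, transpose_spinF, transpose_spinK, transpose_spinKInv]

theorem transpose_coE : (coE γ d)ᵀ = coF γ d := by
  rw [← transpose_coF, Matrix.transpose_transpose]

theorem swapConj_coF : swapConj d (coF γ d) =
    spinKInv γ d ⊗ₖ spinF γ d + spinF γ d ⊗ₖ spinK γ d := by
  rw [coF, map_add, swapConj_kronecker, swapConj_kronecker]

theorem coF_neg : coF (-γ) d = swapConj d (coF γ d) := by
  rw [swapConj_coF, coF, spinF_neg, spinK_neg, spinKInv_neg, add_comm]

theorem coE_neg : coE (-γ) d = swapConj d (coE γ d) := by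
  rw [← transpose_coF, coF_neg, transpose_swapConj, transpose_coF]

theorem spinF_kronecker_spinE_pow_eq_zero : (spinF γ d ⊗ₖ spinE γ d) ^ (d + 1) = 0 := by
  rw [kronecker_pow, spinF_pow_eq_zero d.lt_succ_self, Matrix.zero_kronecker]

theorem spinK_sq_mul_spinE : spinK γ d * spinK γ d * spinE γ d =
    qPow γ 2 • (spinE γ d * (spinK γ d * spinK γ d)) := by
  rw [mul_assoc, spinK_mul_spinE, mul_smul_comm, ← mul_assoc, spinK_mul_spinE, smul_mul_assoc,
    smul_smul, ← qPow_add, mul_assoc, one_add_one_eq_two]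

theorem spinKInv_sq_mul_spinE : spinKInv γ d * spinKInv γ d * spinE γ d =
    qPow γ (-2) • (spinE γ d * (spinKInv γ d * spinKInv γ d)) := by
  simpa only [spinK_neg, spinE_neg, qPow_neg_left] using spinK_sq_mul_spinE (γ := -γ) (d := d)

theorem qExp_semiconj_spinF (h1 : qNum γ 1 ≠ 0) (hf : qFactorial γ d ≠ 0) :
    SemiconjBy (qExp γ d (qDiff γ • (spinF γ d ⊗ₖ spinE γ d)))
      (spinF γ d ⊗ₖ (spinKInv γ d * spinKInv γ d) + 1 ⊗ₖ spinF γ d)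
      (1 ⊗ₖ spinF γ d + spinF γ d ⊗ₖ (spinK γ d * spinK γ d)) := by
  have hcomm : ∀ A B : Matrix (Fin (d + 1)) (Fin (d + 1)) ℂ, Commute (A ⊗ₖ 1) (1 ⊗ₖ B) := by
    intro A B
    simp only [Commute, SemiconjBy, ← Matrix.mul_kronecker_mul, one_mul, mul_one]
  have h := qExp_mul_add (A := TwoSite d) (G := spinF γ d ⊗ₖ 1) (E := 1 ⊗ₖ spinE γ d)
    (F := 1 ⊗ₖ spinF γ d) (k := 1 ⊗ₖ (spinK γ d * spinK γ d))
    (k' := 1 ⊗ₖ (spinKInv γ d * spinKInv γ d)) h1 hf (hcomm _ _) (hcomm _ _) (hcomm _ _)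
    (by rw [← Matrix.mul_kronecker_mul, ← Matrix.mul_kronecker_mul, ← Matrix.kronecker_smul,
      spinK_sq_mul_spinE])
    (by rw [← Matrix.mul_kronecker_mul, ← Matrix.mul_kronecker_mul, ← Matrix.kronecker_smul,
      spinKInv_sq_mul_spinE])
    (by
      rw [← Matrix.mul_kronecker_mul, ← Matrix.mul_kronecker_mul, one_mul, ← kronecker_sub,
        ← kronecker_sub, ← Matrix.kronecker_smul, qDiff_smul_spin_commutator h1])
    (by rw [kronecker_pow, spinF_pow_eq_zero d.lt_succ_self, Matrix.zero_kronecker])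
  simpa only [← Matrix.mul_kronecker_mul, one_mul, mul_one] using h

theorem RPlus_semiconj_coF (h1 : qNum γ 1 ≠ 0) (hf : qFactorial γ d ≠ 0) :
    SemiconjBy (RPlus γ d) (coF γ d) (swapConj d (coF γ d)) := by
  have hright : SemiconjBy (qHH γ d) (coF γ d)
      (spinF γ d ⊗ₖ (spinKInv γ d * spinKInv γ d) + 1 ⊗ₖ spinF γ d) :=
    qHH_semiconj_spinF_kronecker_spinKInv.add_right qHH_semiconj_spinK_kronecker_spinF
  have hleft : SemiconjBy (qHH γ d) (1 ⊗ₖ spinF γ d + spinF γ d ⊗ₖ (spinK γ d * spinK γ d))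
      (swapConj d (coF γ d)) := by
    rw [swapConj_coF]
    exact qHH_semiconj_one_kronecker_spinF.add_right qHH_semiconj_spinF_kronecker_spinK_mul_spinK
  exact (hleft.mul_left (qExp_semiconj_spinF h1 hf)).mul_left hright

theorem transpose_RPlus : (RPlus γ d)ᵀ = swapConj d (RPlus γ d) := by
  rw [RPlus_eq, Matrix.transpose_mul, Matrix.transpose_mul, transpose_qExp,
    Matrix.transpose_smul, ← Matrix.kroneckerMap_transpose, transpose_spinF, transpose_spinE,
    transpose_qHH, map_mul, map_mul, map_qExp, map_smul, swapConj_kronecker, swapConj_qHH,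
    mul_assoc]

theorem RPlus_semiconj_coE (h1 : qNum γ 1 ≠ 0) (hf : qFactorial γ d ≠ 0) :
    SemiconjBy (RPlus γ d) (coE γ d) (swapConj d (coE γ d)) := by
  have h := congrArg (fun A => swapConj d Aᵀ) (RPlus_semiconj_coF h1 hf).eq
  simp only [Matrix.transpose_mul, transpose_RPlus, transpose_swapConj, transpose_coF, map_mul,
    swapConj_swapConj] at h
  exact h.symm

theorem RPlus_mul_RPlus_neg (hf : qFactorial γ d ≠ 0) : RPlus γ d * RPlus (-γ) d = 1 := by
  have hexp : qExp γ d (qDiff γ • (spinF γ d ⊗ₖ spinE γ d)) *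
      qExp (-γ) d (-(qDiff γ • (spinF γ d ⊗ₖ spinE γ d))) = 1 :=
    qExp_mul_qExp_neg hf (by rw [smul_pow, spinF_kronecker_spinE_pow_eq_zero, smul_zero])
  rw [RPlus_eq, RPlus_eq, qDiff_neg, neg_smul, spinF_neg, spinE_neg]
  set X := qExp γ d (qDiff γ • (spinF γ d ⊗ₖ spinE γ d))
  set Y := qExp (-γ) d (-(qDiff γ • (spinF γ d ⊗ₖ spinE γ d)))
  calc qHH γ d * X * qHH γ d * (qHH (-γ) d * Y * qHH (-γ) d)
      = qHH γ d * (X * ((qHH γ d * qHH (-γ) d) * Y)) * qHH (-γ) d := by simp only [mul_assoc]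
    _ = 1 := by rw [qHH_mul_qHH_neg, one_mul, hexp, mul_one, qHH_mul_qHH_neg]

theorem isUnit_RPlus (hf : qFactorial γ d ≠ 0) : IsUnit (RPlus γ d) :=
  IsUnit.of_mul_eq_one _ (RPlus_mul_RPlus_neg hf)

theorem RMinus_eq_swapConj (hf : qFactorial γ d ≠ 0) :
    RMinus γ d = swapConj d (RPlus (-γ) d) := by
  rw [RMinus, flip_mul_mul_flip, Matrix.inv_eq_right_inv (RPlus_mul_RPlus_neg hf)]

theorem IsUnitary.conjTranspose_RPlus (hu : IsUnitary γ d) : (RPlus γ d)ᴴ = RMinus γ d := by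
  rw [RMinus_eq_swapConj hu.qFactorial_ne_zero, RPlus_eq, RPlus_eq, Matrix.conjTranspose_mul,
    Matrix.conjTranspose_mul, conjTranspose_qExp, Matrix.conjTranspose_smul,
    Matrix.conjTranspose_kronecker, hu.conjTranspose_spinF, hu.conjTranspose_spinE, star_qDiff,
    conjTranspose_qHH, map_mul, map_mul, map_qExp, map_smul, swapConj_kronecker, swapConj_qHH,
    spinF_neg, spinE_neg, mul_assoc]

end TwoSites

/-! ### The Casimir operator of two sites -/

theorem commute_diagonal_iff {m R : Type*} [Fintype m] [DecidableEq m] [CommRing R] [IsDomain R]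
    {f : m → R} {A : Matrix m m R} :
    Commute (Matrix.diagonal f) A ↔ ∀ x y, A x y ≠ 0 → f x = f y := by
  simp only [Commute, SemiconjBy, ← Matrix.ext_iff, Matrix.diagonal_mul, Matrix.mul_diagonal,
    mul_comm (A _ _), mul_eq_mul_right_iff, or_iff_not_imp_right, ne_eq]

section Casimir

variable {γ : ℝ} {d : ℕ}

/-- The total weight of a basis vector of the tensor square. -/
def totalWeight (d : ℕ) (x : Fin (d + 1) × Fin (d + 1)) : ℝ := weight d x.1 + weight d x.2

/-- `Δ(H) = H ⊗ 1 + 1 ⊗ H` on the tensor square. -/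
def coH (d : ℕ) : TwoSite d := Matrix.diagonal fun x => (totalWeight d x : ℂ)

theorem commute_coH_iff {A : TwoSite d} :
    Commute (coH d) A ↔ ∀ x y, A x y ≠ 0 → totalWeight d x = totalWeight d y := by
  simp only [coH, commute_diagonal_iff, Complex.ofReal_inj]

theorem weight_of_spinE_apply_ne_zero {i j : Fin (d + 1)} (h : spinE γ d i j ≠ 0) :
    weight d i = weight d j + 1 := by
  rw [spinE_apply] at h
  exact weight_of_eq_add_one (ite_ne_right_iff.1 h).1

theorem commute_coH_spinF_kronecker_spinE : Commute (coH d) (spinF γ d ⊗ₖ spinE γ d) := by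
  refine commute_coH_iff.2 fun x y h => ?_
  rw [Matrix.kronecker_apply, ← transpose_spinE, Matrix.transpose_apply] at h
  rw [totalWeight, totalWeight, weight_of_spinE_apply_ne_zero (left_ne_zero_of_mul h),
    weight_of_spinE_apply_ne_zero (right_ne_zero_of_mul h)]
  ring

theorem commute_coH_RPlus : Commute (coH d) (RPlus γ d) := by
  have hH : Commute (coH d) (qHH γ d) := Matrix.commute_diagonal _ _
  have hexp := semiconjBy_qExp (SemiconjBy.smul_right
    (commute_coH_spinF_kronecker_spinE (γ := γ) (d := d)) (qDiff γ)) γ d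
  rw [RPlus_eq]
  exact (hH.mul_right hexp).mul_right hH

theorem totalWeight_of_coE_apply_ne_zero {x y} (h : coE γ d x y ≠ 0) :
    totalWeight d x = totalWeight d y + 1 := by
  rw [coE, Matrix.add_apply, Matrix.kronecker_apply, Matrix.kronecker_apply, spinK, spinKInv] at h
  have hdiag : ∀ {f : Fin (d + 1) → ℂ} {i j}, Matrix.diagonal f i j ≠ 0 → i = j :=
    fun hij => by_contra fun hne => hij (Matrix.diagonal_apply_ne _ hne)
  by_cases h0 : spinE γ d x.1 y.1 * Matrix.diagonal (fun i => qPow γ (-weight d i)) x.2 y.2 = 0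
  · rw [h0, zero_add] at h
    rw [totalWeight, totalWeight, weight_of_spinE_apply_ne_zero (right_ne_zero_of_mul h),
      hdiag (left_ne_zero_of_mul h)]
    ring
  · rw [totalWeight, totalWeight, weight_of_spinE_apply_ne_zero (left_ne_zero_of_mul h0),
      hdiag (right_ne_zero_of_mul h0)]
    ring

theorem totalWeight_of_coF_apply_ne_zero {x y} (h : coF γ d x y ≠ 0) :
    totalWeight d y = totalWeight d x + 1 := by
  rw [← transpose_coE] at h
  exact totalWeight_of_coE_apply_ne_zero h

theorem co_commutator_eq_kronecker : coE γ d * coF γ d - coF γ d * coE γ d =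
    (spinE γ d * spinF γ d - spinF γ d * spinE γ d) ⊗ₖ (spinKInv γ d * spinKInv γ d) +
      (spinK γ d * spinK γ d) ⊗ₖ (spinE γ d * spinF γ d - spinF γ d * spinE γ d) := by
  have hq : qPow γ (-1) * qPow γ 1 = 1 := by rw [mul_comm, qPow_mul_qPow_neg]
  have hEF : (spinK γ d * spinE γ d) ⊗ₖ (spinF γ d * spinKInv γ d) =
      (spinE γ d * spinK γ d) ⊗ₖ (spinKInv γ d * spinF γ d) := by
    rw [spinK_mul_spinE, spinF_mul_spinKInv, Matrix.kronecker_smul, Matrix.smul_kronecker,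
      smul_smul, hq, one_smul]
  have hFE : (spinF γ d * spinK γ d) ⊗ₖ (spinKInv γ d * spinE γ d) =
      (spinK γ d * spinF γ d) ⊗ₖ (spinE γ d * spinKInv γ d) := by
    rw [spinF_mul_spinK, spinKInv_mul_spinE, Matrix.kronecker_smul, Matrix.smul_kronecker,
      smul_smul, hq, one_smul]
  rw [sub_kronecker, kronecker_sub]
  simp only [coE, coF, mul_add, add_mul, ← Matrix.mul_kronecker_mul]
  rw [hEF, hFE]
  abel

theorem co_commutator (h1 : qNum γ 1 ≠ 0) : coE γ d * coF γ d - coF γ d * coE γ d =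
    Matrix.diagonal fun x => (qNum γ (2 * totalWeight d x) : ℂ) := by
  rw [co_commutator_eq_kronecker, spin_commutator h1, spinK, spinKInv,
    Matrix.diagonal_mul_diagonal, Matrix.diagonal_mul_diagonal, Matrix.diagonal_kronecker_diagonal,
    Matrix.diagonal_kronecker_diagonal, Matrix.diagonal_add]
  congr 1
  ext x
  rw [totalWeight, mul_add, qNum_add, ← qPow_add, ← qPow_add, ← neg_add, ← two_mul, ← two_mul]
  ring

/-- The diagonal part `[H + 1/2]²` of the Casimir operator of the tensor square. -/
def casimirDiag (γ : ℝ) (d : ℕ) : TwoSite d :=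
  Matrix.diagonal fun x => ((qNum γ (totalWeight d x + 1 / 2) ^ 2 : ℝ) : ℂ)

/-- The Casimir operator `F E + [H + 1/2]²` of the tensor square. It separates the summands `V^s`,
on which it acts as `[s + 1/2]²`. -/
def casimir (γ : ℝ) (d : ℕ) : TwoSite d := coF γ d * coE γ d + casimirDiag γ d

theorem commute_casimirDiag {A : TwoSite d} (h : Commute (coH d) A) : Commute (casimirDiag γ d) A :=
  commute_diagonal_iff.2 fun x y hA => by rw [commute_coH_iff.1 h x y hA]

theorem swapConj_casimirDiag : swapConj d (casimirDiag γ d) = casimirDiag γ d := by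
  rw [casimirDiag, swapConj_diagonal]
  simp only [totalWeight, Prod.fst_swap, Prod.snd_swap, add_comm]

theorem casimir_neg : casimir (-γ) d = swapConj d (casimir γ d) := by
  rw [casimir, casimir, coF_neg, coE_neg, map_add, map_mul, swapConj_casimirDiag]
  simp only [casimirDiag, qNum_neg_left]

theorem transpose_casimir : (casimir γ d)ᵀ = casimir γ d := by
  rw [casimir, Matrix.transpose_add, Matrix.transpose_mul, transpose_coE, transpose_coF,
    casimirDiag, Matrix.diagonal_transpose]

theorem IsUnitary.conjTranspose_coF (hu : IsUnitary γ d) : (coF γ d)ᴴ = coE (-γ) d := by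
  rw [coF, coE, Matrix.conjTranspose_add, Matrix.conjTranspose_kronecker,
    Matrix.conjTranspose_kronecker, hu.conjTranspose_spinF, conjTranspose_spinK,
    conjTranspose_spinKInv, spinE_neg, spinK_neg, spinKInv_neg]

theorem IsUnitary.conjTranspose_casimir (hu : IsUnitary γ d) :
    (casimir γ d)ᴴ = swapConj d (casimir γ d) := by
  have hE : (coE γ d)ᴴ = coF (-γ) d := by
    rw [← Matrix.conjTranspose_conjTranspose (coF (-γ) d), hu.neg.conjTranspose_coF, neg_neg]
  have hdiag : (casimirDiag γ d)ᴴ = casimirDiag (-γ) d := by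
    simp only [casimirDiag, Matrix.diagonal_conjTranspose, qNum_neg_left]
    exact congrArg Matrix.diagonal (funext fun x => Complex.conj_ofReal _)
  rw [← casimir_neg, casimir, casimir, Matrix.conjTranspose_add, Matrix.conjTranspose_mul, hE,
    hu.conjTranspose_coF, hdiag]

theorem commute_coH_casimir : Commute (coH d) (casimir γ d) := by
  refine Commute.add_right (commute_coH_iff.2 fun x y h => ?_) (Matrix.commute_diagonal _ _)
  rw [Matrix.mul_apply] at h
  obtain ⟨z, _, hz⟩ := Finset.exists_ne_zero_of_sum_ne_zero h
  have hxz := totalWeight_of_coF_apply_ne_zero (left_ne_zero_of_mul hz)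
  have hzy := totalWeight_of_coE_apply_ne_zero (right_ne_zero_of_mul hz)
  linarith

theorem casimirDiag_mul_coF : casimirDiag γ d * coF γ d = coF γ d *
    Matrix.diagonal fun x => ((qNum γ (totalWeight d x - 1 / 2) ^ 2 : ℝ) : ℂ) := by
  ext x y
  rw [casimirDiag, Matrix.diagonal_mul, Matrix.mul_diagonal, mul_comm]
  by_cases h : coF γ d x y = 0
  · rw [h, zero_mul, zero_mul]
  · rw [totalWeight_of_coF_apply_ne_zero h]
    ring_nf

theorem casimir_eq_coE_mul_coF_add (h1 : qNum γ 1 ≠ 0) : casimir γ d = coE γ d * coF γ d +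
    Matrix.diagonal fun x => ((qNum γ (totalWeight d x - 1 / 2) ^ 2 : ℝ) : ℂ) := by
  rw [casimir, eq_add_of_sub_eq (co_commutator h1), add_comm _ (coF γ d * coE γ d), add_assoc,
    Matrix.diagonal_add, casimirDiag]
  congr 2
  ext x
  have h := qNum_sq_sub_sq γ (totalWeight d x + 1 / 2) (totalWeight d x - 1 / 2)
  rw [show totalWeight d x + 1 / 2 - (totalWeight d x - 1 / 2) = 1 by ring,
    show totalWeight d x + 1 / 2 + (totalWeight d x - 1 / 2) = 2 * totalWeight d x by ring,
    qNum_one h1, mul_one] at h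
  exact_mod_cast sub_eq_iff_eq_add.1 h

theorem commute_casimir_coF (h1 : qNum γ 1 ≠ 0) : Commute (casimir γ d) (coF γ d) := by
  rw [Commute, SemiconjBy]
  nth_rewrite 2 [casimir_eq_coE_mul_coF_add h1]
  rw [casimir, add_mul, mul_add, mul_assoc, casimirDiag_mul_coF]

theorem RPlus_semiconj_casimir (h1 : qNum γ 1 ≠ 0) (hf : qFactorial γ d ≠ 0) :
    SemiconjBy (RPlus γ d) (casimir γ d) (swapConj d (casimir γ d)) := by
  rw [casimir, map_add, map_mul, swapConj_casimirDiag]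
  exact ((RPlus_semiconj_coF h1 hf).mul_right (RPlus_semiconj_coE h1 hf)).add_right
    (commute_casimirDiag commute_coH_RPlus).symm

end Casimir

/-! ### Operators on the chain -/

section Embedding

variable {N d : ℕ}

/-- The operator on the chain that acts as `A` at the site `n`. -/
def site (A : Matrix (Fin (d + 1)) (Fin (d + 1)) ℂ) (n : Fin N) : Chain N d := fun x y =>
  if ∀ j, j ≠ n → x j = y j then A (x n) (y n) else 0

theorem site_mul_apply (A : Matrix (Fin (d + 1)) (Fin (d + 1)) ℂ) (n : Fin N) (X : Chain N d)
    (x y : Fin N → Fin (d + 1)) :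
    (site A n * X) x y = ∑ i, A (x n) i * X (Function.update x n i) y := by
  rw [Matrix.mul_apply]
  refine (Finset.sum_of_injOn (Function.update x n) (Function.update_injective x n).injOn
    (by simp) (fun z _ hz => ?_) fun i _ => ?_).symm
  · rw [site, if_neg, zero_mul]
    intro h
    exact hz ⟨z n, by simp, Function.update_eq_iff.2 ⟨rfl, h⟩⟩
  · rw [site, if_pos fun j hj => (Function.update_of_ne hj _ _).symm, Function.update_self]

theorem site_mul (A B : Matrix (Fin (d + 1)) (Fin (d + 1)) ℂ) (n : Fin N) :
    site (A * B) n = site A n * site B n := by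
  ext x y
  have update_agree : ∀ i, (∀ j, j ≠ n → Function.update x n i j = y j) ↔
      ∀ j, j ≠ n → x j = y j := fun i =>
    forall₂_congr fun j hj => by rw [Function.update_of_ne hj]
  rw [site_mul_apply]
  simp only [site, Function.update_self, update_agree, mul_ite, mul_zero]
  split_ifs
  · rfl
  · exact Finset.sum_const_zero.symm

theorem site_zero (n : Fin N) : site (0 : Matrix (Fin (d + 1)) (Fin (d + 1)) ℂ) n = 0 :=
  Matrix.ext fun _ _ => ite_self _

theorem site_one (n : Fin N) : site (1 : Matrix (Fin (d + 1)) (Fin (d + 1)) ℂ) n = 1 := by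
  ext x y
  have eq_iff : x = y ↔ (∀ j, j ≠ n → x j = y j) ∧ x n = y n := by
    refine ⟨fun h => by simp [h], fun ⟨h, hn⟩ => funext fun j => ?_⟩
    rcases eq_or_ne j n with rfl | hj
    exacts [hn, h j hj]
  simp only [site, Matrix.one_apply, ← ite_and, eq_iff]

theorem site_pow (A : Matrix (Fin (d + 1)) (Fin (d + 1)) ℂ) (n : Fin N) (k : ℕ) :
    site A n ^ k = site (A ^ k) n := by
  induction k with
  | zero => rw [pow_zero, pow_zero, site_one]
  | succ k ih => rw [pow_succ, ih, ← site_mul, ← pow_succ]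

theorem embed_kronecker (A B : Matrix (Fin (d + 1)) (Fin (d + 1)) ℂ) {a b : Fin N} (h : a ≠ b) :
    embed (A ⊗ₖ B) a b = site A a * site B b := by
  ext x y
  have update_agree : (∀ j, j ≠ b → Function.update x a (y a) j = y j) ↔
      ∀ j, j ≠ a → j ≠ b → x j = y j := by
    refine forall_congr' fun j => ?_
    rcases eq_or_ne j a with rfl | hj
    · simp
    · simp [hj]
  rw [site_mul_apply, Finset.sum_eq_single_of_mem (y a) (Finset.mem_univ _)]
  · simp only [embed, site, Matrix.kronecker_apply, Function.update_of_ne h.symm, update_agree,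
      mul_ite, mul_zero]
  · intro i _ hi
    rw [site, if_neg, mul_zero]
    intro h'
    exact hi (by simpa using h' a h)

theorem embed_swapConj (A : TwoSite d) (a b : Fin N) : embed (swapConj d A) a b = embed A b a := by
  ext x y
  have agree_comm : (∀ j, j ≠ a → j ≠ b → x j = y j) ↔ ∀ j, j ≠ b → j ≠ a → x j = y j :=
    forall_congr' fun j => Imp.swap
  simp only [embed, swapConj_apply, Prod.swap, agree_comm]

theorem site_commute (A B : Matrix (Fin (d + 1)) (Fin (d + 1)) ℂ) {a b : Fin N} (h : a ≠ b) :
    Commute (site A a) (site B b) := by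
  rw [Commute, SemiconjBy, ← embed_kronecker A B h, ← embed_kronecker B A h.symm,
    ← embed_swapConj, swapConj_kronecker]

theorem embed_add (A B : TwoSite d) (a b : Fin N) :
    embed (A + B) a b = embed A a b + embed B a b := by
  ext x y
  simp only [embed, Matrix.add_apply]
  split_ifs
  exacts [rfl, (add_zero 0).symm]

theorem embed_smul (c : ℂ) (A : TwoSite d) (a b : Fin N) :
    embed (c • A) a b = c • embed A a b := by
  ext x y
  simp only [embed, Matrix.smul_apply, smul_ite, smul_zero]

theorem kronecker_induction {p : TwoSite d → Prop} (kronecker : ∀ A B, p (A ⊗ₖ B))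
    (add : ∀ A B, p A → p B → p (A + B)) (A : TwoSite d) : p A := by
  refine A.induction_on add fun i j c => ?_
  rw [show Matrix.single i j c = Matrix.single i.1 j.1 c ⊗ₖ Matrix.single i.2 j.2 1 by
    rw [Matrix.single_kronecker_single, mul_one]]
  exact kronecker _ _

theorem embed_mul (A B : TwoSite d) {a b : Fin N} (h : a ≠ b) :
    embed (A * B) a b = embed A a b * embed B a b := by
  induction A using kronecker_induction with
  | add A A' ih ih' => rw [add_mul, embed_add, embed_add, add_mul, ih, ih']
  | kronecker A A' =>
    induction B using kronecker_induction with
    | add B B' ih ih' => rw [mul_add, embed_add, embed_add, mul_add, ih, ih']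
    | kronecker B B' =>
      rw [← Matrix.mul_kronecker_mul, embed_kronecker _ _ h, embed_kronecker _ _ h,
        embed_kronecker _ _ h, site_mul, site_mul, (site_commute A' B h.symm).mul_mul_mul_comm]

/-- The embedding `A ↦ A_{a b}` as a homomorphism of algebras. -/
def embedHom {a b : Fin N} (h : a ≠ b) : TwoSite d →ₐ[ℂ] Chain N d :=
  AlgHom.ofLinearMap
    { toFun := fun A => embed A a b
      map_add' := fun A B => embed_add A B a b
      map_smul' := fun c A => embed_smul c A a b }
    (by
      change embed 1 a b = 1
      rw [← Matrix.one_kronecker_one, embed_kronecker _ _ h, site_one, site_one, one_mul])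
    fun A B => embed_mul A B h

theorem embedHom_apply {a b : Fin N} (h : a ≠ b) (A : TwoSite d) :
    embedHom h A = embed A a b := rfl

theorem embed_semiconj {A B C : TwoSite d} {a b : Fin N} (h : a ≠ b) (hs : SemiconjBy A B C) :
    SemiconjBy (embed A a b) (embed B a b) (embed C a b) := hs.map (embedHom h)

theorem transpose_embed (A : TwoSite d) (a b : Fin N) : (embed A a b)ᵀ = embed Aᵀ a b := by
  ext x y
  simp only [embed, Matrix.transpose_apply, eq_comm]

theorem conjTranspose_embed (A : TwoSite d) (a b : Fin N) : (embed A a b)ᴴ = embed Aᴴ a b := by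
  ext x y
  simp only [embed, Matrix.conjTranspose_apply, apply_ite star, star_zero, eq_comm]

theorem embed_commute_site (A : TwoSite d) (B : Matrix (Fin (d + 1)) (Fin (d + 1)) ℂ)
    {a b c : Fin N} (hab : a ≠ b) (hac : a ≠ c) (hbc : b ≠ c) :
    Commute (embed A a b) (site B c) := by
  induction A using kronecker_induction with
  | add A A' ih ih' =>
    rw [embed_add]
    exact ih.add_left ih'
  | kronecker A A' =>
    rw [embed_kronecker _ _ hab]
    exact (site_commute _ _ hac).mul_left (site_commute _ _ hbc)

theorem embed_commute_embed (A B : TwoSite d) {a b c e : Fin N} (hab : a ≠ b) (hce : c ≠ e)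
    (hac : a ≠ c) (hae : a ≠ e) (hbc : b ≠ c) (hbe : b ≠ e) :
    Commute (embed A a b) (embed B c e) := by
  induction B using kronecker_induction with
  | add B B' ih ih' =>
    rw [embed_add]
    exact ih.add_right ih'
  | kronecker B B' =>
    rw [embed_kronecker _ _ hce]
    exact (embed_commute_site A B hab hac hbc).mul_right (embed_commute_site A B' hab hae hbe)

theorem embed_diagonal (f : Fin (d + 1) × Fin (d + 1) → ℂ) (a b : Fin N) :
    embed (Matrix.diagonal f) a b = Matrix.diagonal fun x => f (x a, x b) := by
  ext x y
  have eq_iff : x = y ↔ (∀ j, j ≠ a → j ≠ b → x j = y j) ∧ (x a, x b) = (y a, y b) := by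
    refine ⟨fun h => by simp [h], fun ⟨h, hab⟩ => funext fun j => ?_⟩
    rcases eq_or_ne j a with rfl | ha
    · exact congrArg Prod.fst hab
    rcases eq_or_ne j b with rfl | hb
    · exact congrArg Prod.snd hab
    · exact h j ha hb
  simp only [embed, Matrix.diagonal_apply, ← ite_and, eq_iff]

end Embedding

/-! ### Fusion and the Yang–Baxter equation -/

section Fusion

variable {N d : ℕ} {γ : ℝ}

/-- The diagonal factor `q ^ ((H_a + H_b) H_c)` of a fused pair of R-matrices. -/
def fusedDiag (γ : ℝ) (d : ℕ) (a b c : Fin N) : Chain N d :=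
  embed (qHH γ d) a c * embed (qHH γ d) b c

theorem fusedDiag_eq (a b c : Fin N) : fusedDiag γ d a b c = Matrix.diagonal fun x =>
    qPow γ (totalWeight d (x a, x b) * weight d (x c)) := by
  simp only [fusedDiag, qHH, embed_diagonal, Matrix.diagonal_mul_diagonal, ← qPow_add, totalWeight,
    add_mul]

theorem fusedDiag_comm (a b c : Fin N) : fusedDiag γ d a b c = fusedDiag γ d b a c := by
  simp only [fusedDiag_eq, totalWeight, add_comm]

theorem embed_commute_fusedDiag {A : TwoSite d} (h : Commute (coH d) A) {a b c : Fin N}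
    (hac : a ≠ c) (hbc : b ≠ c) : Commute (embed A a b) (fusedDiag γ d a b c) := by
  rw [fusedDiag_eq]
  refine (commute_diagonal_iff.2 fun x y hA => ?_).symm
  obtain ⟨hxy, hA⟩ := ite_ne_right_iff.1 hA
  rw [hxy c hac.symm hbc.symm, commute_coH_iff.1 h _ _ hA]

theorem embed_RPlus {a c : Fin N} (h : a ≠ c) : embed (RPlus γ d) a c = embed (qHH γ d) a c *
    qExp γ d (qDiff γ • (site (spinF γ d) a * site (spinE γ d) c)) * embed (qHH γ d) a c := by
  rw [← embed_kronecker _ _ h, ← embedHom_apply h, ← embedHom_apply h, ← embedHom_apply h,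
    ← map_smul, ← map_qExp, ← map_mul, ← map_mul, RPlus_eq]

theorem embed_qHH_semiconj_spinF_kronecker_spinKInv {a b c : Fin N} (hab : a ≠ b) (hac : a ≠ c)
    (hbc : b ≠ c) : SemiconjBy (embed (qHH γ d) b c)
      (embed (spinF γ d ⊗ₖ spinKInv γ d) a b * site (spinE γ d) c)
      (site (spinF γ d) a * site (spinE γ d) c) := by
  have h := embed_semiconj hbc (qHH_semiconj_spinKInv_kronecker_spinE (γ := γ) (d := d))
  rw [embed_kronecker _ _ hbc, embed_kronecker _ _ hbc, site_one, one_mul] at h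
  rw [embed_kronecker _ _ hab, mul_assoc]
  exact SemiconjBy.mul_right (embed_commute_site _ _ hbc hab.symm hac.symm) h

theorem embed_qHH_semiconj_spinK_kronecker_spinF {a b c : Fin N} (hab : a ≠ b) (hac : a ≠ c)
    (hbc : b ≠ c) : SemiconjBy (embed (qHH γ d) a c) (site (spinF γ d) b * site (spinE γ d) c)
      (embed (spinK γ d ⊗ₖ spinF γ d) a b * site (spinE γ d) c) := by
  have h := embed_semiconj hac (qHH_semiconj_one_kronecker_spinE (γ := γ) (d := d))
  rw [embed_kronecker _ _ hac, embed_kronecker _ _ hac, site_one, one_mul] at h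
  rw [embed_kronecker _ _ hab, (site_commute _ _ hab).eq, mul_assoc]
  exact SemiconjBy.mul_right (embed_commute_site _ _ hac hab hbc.symm) h

theorem coF_summands_mul : (spinK γ d ⊗ₖ spinF γ d) * (spinF γ d ⊗ₖ spinKInv γ d) =
    qPow γ (-2) • ((spinF γ d ⊗ₖ spinKInv γ d) * (spinK γ d ⊗ₖ spinF γ d)) := by
  rw [← Matrix.mul_kronecker_mul, ← Matrix.mul_kronecker_mul, spinF_mul_spinK,
    spinF_mul_spinKInv, Matrix.kronecker_smul, Matrix.smul_kronecker, smul_smul, ← qPow_add]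
  norm_num

theorem qExp_coF (hf : qFactorial γ d ≠ 0) {a b c : Fin N} (hab : a ≠ b) (hac : a ≠ c)
    (hbc : b ≠ c) :
    qExp γ d (qDiff γ • (embed (spinF γ d ⊗ₖ spinKInv γ d) a b * site (spinE γ d) c)) *
        qExp γ d (qDiff γ • (embed (spinK γ d ⊗ₖ spinF γ d) a b * site (spinE γ d) c)) =
      qExp γ d (qDiff γ • (embed (coF γ d) a b * site (spinE γ d) c)) := by
  set U := embed (spinF γ d ⊗ₖ spinKInv γ d) a b with hU
  set V := embed (spinK γ d ⊗ₖ spinF γ d) a b with hV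
  set E := site (spinE γ d) c
  have hUE : Commute U E := embed_commute_site _ _ hab hac hbc
  have hVE : Commute V E := embed_commute_site _ _ hab hac hbc
  have hVU : V * U = qPow γ (-2) • (U * V) := by
    rw [hU, hV, ← embed_mul _ _ hab, ← embed_mul _ _ hab, coF_summands_mul, embed_smul]
  have hskew : qDiff γ • (V * E) * qDiff γ • (U * E) =
      qPow γ (-2) • (qDiff γ • (U * E) * qDiff γ • (V * E)) := by
    rw [smul_mul_smul_comm, smul_mul_smul_comm, hUE.symm.mul_mul_mul_comm,
      hVE.symm.mul_mul_mul_comm, hVU, smul_mul_assoc, smul_comm]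
  have hzero : ∀ k l, d < k + l → (qDiff γ • (U * E)) ^ k * (qDiff γ • (V * E)) ^ l = 0 := by
    intro k l hkl
    rw [smul_pow, smul_pow, hUE.mul_pow, hVE.mul_pow, smul_mul_smul_comm,
      (hVE.symm.pow_pow k l).mul_mul_mul_comm, ← pow_add, ← pow_add E, site_pow,
      spinE_pow_eq_zero hkl, site_zero, mul_zero, smul_zero]
  rw [qExp_mul_qExp hf hskew hzero, ← smul_add, ← add_mul, ← embed_add, coF]

-- This is `(Δ ⊗ id) R = R₁₃ R₂₃` in the spin module.
theorem RPlus_fusion (hf : qFactorial γ d ≠ 0) {a b c : Fin N} (hab : a ≠ b) (hac : a ≠ c)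
    (hbc : b ≠ c) : embed (RPlus γ d) a c * embed (RPlus γ d) b c = fusedDiag γ d a b c *
      qExp γ d (qDiff γ • (embed (coF γ d) a b * site (spinE γ d) c)) * fusedDiag γ d a b c := by
  have hU := semiconjBy_qExp (SemiconjBy.smul_right
    (embed_qHH_semiconj_spinF_kronecker_spinKInv (γ := γ) (d := d) hab hac hbc) (qDiff γ)) γ d
  have hV := semiconjBy_qExp (SemiconjBy.smul_right
    (embed_qHH_semiconj_spinK_kronecker_spinF (γ := γ) (d := d) hab hac hbc) (qDiff γ)) γ d
  rw [embed_RPlus hac, embed_RPlus hbc, ← qExp_coF hf hab hac hbc, fusedDiag]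
  set Da := embed (qHH γ d) a c
  set Db := embed (qHH γ d) b c
  set X := qExp γ d (qDiff γ • (site (spinF γ d) a * site (spinE γ d) c))
  set Y := qExp γ d (qDiff γ • (site (spinF γ d) b * site (spinE γ d) c))
  have hD : Da * Db = Db * Da := fusedDiag_comm a b c
  calc Da * X * Da * (Db * Y * Db) = Da * X * (Da * Db) * Y * Db := by simp only [mul_assoc]
    _ = Da * (X * Db) * (Da * Y) * Db := by rw [hD]; simp only [mul_assoc]
    _ = _ := by rw [← hU.eq, hV.eq]; simp only [mul_assoc]

/-- The properties of an R-matrix from which the metric operators inherit theirs; `C` is the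
Casimir operator. The last two fields say that `C` at two sites commutes with the R-matrix of this
pair with a third site, from either side. -/
structure IsRMatrix (N : ℕ) (C R : TwoSite d) : Prop where
  semiconj : SemiconjBy R C (swapConj d C)
  yangBaxter : ∀ {a b c : Fin N}, a ≠ b → a ≠ c → b ≠ c →
    embed R a b * embed R a c * embed R b c = embed R b c * embed R a c * embed R a b
  commute_first : ∀ {a b c : Fin N}, a ≠ b → a ≠ c → b ≠ c →
    Commute (embed R a c * embed R b c) (embed C a b)
  commute_second : ∀ {a b c : Fin N}, a ≠ b → a ≠ c → b ≠ c →
    Commute (embed R c b * embed R c a) (embed C a b)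

theorem IsRMatrix.swapConj {C R : TwoSite d} (h : IsRMatrix N C R) :
    IsRMatrix N (swapConj d C) (swapConj d R) where
  semiconj := h.semiconj.map (SpinChain.swapConj d)
  yangBaxter hab hac hbc := by
    simp only [embed_swapConj]
    exact (h.yangBaxter hbc.symm hac.symm hab.symm).symm
  commute_first hab hac hbc := by
    simp only [embed_swapConj]
    exact h.commute_second hab.symm hbc hac
  commute_second hab hac hbc := by
    simp only [embed_swapConj]
    exact h.commute_first hab.symm hbc hac

theorem RPlus_commute_casimir (h1 : qNum γ 1 ≠ 0) (hf : qFactorial γ d ≠ 0) {a b c : Fin N}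
    (hab : a ≠ b) (hac : a ≠ c) (hbc : b ≠ c) :
    Commute (embed (RPlus γ d) a c * embed (RPlus γ d) b c) (embed (casimir γ d) a b) := by
  have hD : Commute (embed (casimir γ d) a b) (fusedDiag γ d a b c) :=
    embed_commute_fusedDiag commute_coH_casimir hac hbc
  have hF : Commute (embed (casimir γ d) a b) (embed (coF γ d) a b * site (spinE γ d) c) :=
    Commute.mul_right (embed_semiconj hab (commute_casimir_coF h1))
      (embed_commute_site _ _ hab hac hbc)
  rw [RPlus_fusion hf hab hac hbc]
  exact ((hD.mul_right (semiconjBy_qExp (SemiconjBy.smul_right hF _) _ _)).mul_right hD).symm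

theorem RPlus_yangBaxter (h1 : qNum γ 1 ≠ 0) (hf : qFactorial γ d ≠ 0) {a b c : Fin N}
    (hab : a ≠ b) (hac : a ≠ c) (hbc : b ≠ c) :
    embed (RPlus γ d) a b * embed (RPlus γ d) a c * embed (RPlus γ d) b c =
      embed (RPlus γ d) b c * embed (RPlus γ d) a c * embed (RPlus γ d) a b := by
  have hD : SemiconjBy (embed (RPlus γ d) a b) (fusedDiag γ d a b c) (fusedDiag γ d b a c) := by
    rw [fusedDiag_comm b a c]
    exact embed_commute_fusedDiag commute_coH_RPlus hac hbc
  have hF : SemiconjBy (embed (RPlus γ d) a b) (embed (coF γ d) a b * site (spinE γ d) c)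
      (embed (coF γ d) b a * site (spinE γ d) c) := by
    refine SemiconjBy.mul_right ?_ (embed_commute_site _ _ hab hac hbc)
    rw [← embed_swapConj _ a b]
    exact embed_semiconj hab (RPlus_semiconj_coF h1 hf)
  rw [mul_assoc, RPlus_fusion hf hab hac hbc, RPlus_fusion hf hab.symm hbc hac]
  exact ((hD.mul_right (semiconjBy_qExp (SemiconjBy.smul_right hF _) _ _)).mul_right hD).eq

theorem isRMatrix_RPlus (h1 : qNum γ 1 ≠ 0) (hf : qFactorial γ d ≠ 0) :
    IsRMatrix N (casimir γ d) (RPlus γ d) where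
  semiconj := RPlus_semiconj_casimir h1 hf
  yangBaxter := RPlus_yangBaxter h1 hf
  commute_first := RPlus_commute_casimir h1 hf
  commute_second hab hac hbc := by
    have h := congrArg Matrix.transpose (RPlus_commute_casimir h1 hf hab hac hbc).eq
    simp only [Matrix.transpose_mul, transpose_embed, transpose_RPlus, transpose_casimir,
      embed_swapConj] at h
    exact h.symm

theorem isRMatrix_RMinus (h1 : qNum γ 1 ≠ 0) (hf : qFactorial γ d ≠ 0) :
    IsRMatrix N (casimir γ d) (RMinus γ d) := by
  have h := (isRMatrix_RPlus (N := N) (γ := -γ) (d := d) (by rwa [qNum_neg_left])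
    (by rwa [qFactorial_neg])).swapConj
  rwa [casimir_neg, swapConj_swapConj, ← RMinus_eq_swapConj hf] at h

end Fusion

/-! ### Ordered products -/

section OrderedProducts

variable {ι M : Type*} [Monoid M] {r : ι → ι → M}

/-- The product `r jₖ z ⋯ r j₁ z` over a list `j₁, …, jₖ`, the abstract form of `leftArrow`. -/
def leftProd (r : ι → ι → M) (l : List ι) (z : ι) : M := (l.reverse.map fun j => r j z).prod

/-- The product `r y j₁ ⋯ r y jₖ` over a list `j₁, …, jₖ`, the abstract form of `rightArrow`. -/
def rightProd (r : ι → ι → M) (y : ι) (l : List ι) : M := (l.map fun j => r y j).prod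

/-- The product `r j₁ z ⋯ r jₖ z` over a list `j₁, …, jₖ`, which is what taking adjoints makes of
a `leftProd`. -/
def columnProd (r : ι → ι → M) (l : List ι) (z : ι) : M := (l.map fun j => r j z).prod

theorem leftProd_cons (y : ι) (l : List ι) (z : ι) :
    leftProd r (y :: l) z = leftProd r l z * r y z := by
  simp [leftProd]

theorem leftProd_append (l l' : List ι) (z : ι) :
    leftProd r (l ++ l') z = leftProd r l' z * leftProd r l z := by
  simp [leftProd]

theorem rightProd_cons (y x : ι) (l : List ι) :
    rightProd r y (x :: l) = r y x * rightProd r y l := List.prod_cons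

theorem rightProd_append_singleton (y : ι) (l : List ι) (z : ι) :
    rightProd r y (l ++ [z]) = rightProd r y l * r y z := by
  simp [rightProd]

theorem columnProd_cons (y : ι) (l : List ι) (z : ι) :
    columnProd r (y :: l) z = r y z * columnProd r l z := List.prod_cons

theorem commute_leftProd {x : M} {l : List ι} {z : ι} (h : ∀ j ∈ l, Commute x (r j z)) :
    Commute x (leftProd r l z) :=
  Commute.list_prod_right _ _ (by simpa using h)

theorem commute_rightProd {x : M} {l : List ι} {y : ι} (h : ∀ j ∈ l, Commute x (r y j)) :
    Commute x (rightProd r y l) :=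
  Commute.list_prod_right _ _ (by simpa using h)

theorem star_leftProd [StarMul M] (l : List ι) (z : ι) :
    star (leftProd r l z) = columnProd (fun a b => star (r a b)) l z := by
  induction l with
  | nil => exact star_one M
  | cons y l ih => rw [leftProd_cons, star_mul, ih, columnProd_cons]

/-- The elements attached to disjoint pairs of sites commute. -/
def DisjointCommute (r : ι → ι → M) : Prop :=
  ∀ a b c e : ι, a ≠ b → c ≠ e → a ≠ c → a ≠ e → b ≠ c → b ≠ e → Commute (r a b) (r c e)

/-- The Yang–Baxter equation for distinct sites. -/
def YangBaxter (r : ι → ι → M) : Prop :=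
  ∀ a b c : ι, a ≠ b → a ≠ c → b ≠ c → r a b * r a c * r b c = r b c * r a c * r a b

theorem YangBaxter.leftProd_mul_rightProd (hyb : YangBaxter r) (hc : DisjointCommute r) {y z : ι}
    (hyz : y ≠ z) {l : List ι} (hl : l.Nodup) (hy : y ∉ l) (hz : z ∉ l) :
    leftProd r l z * r y z * rightProd r y l = rightProd r y l * r y z * leftProd r l z := by
  induction l with
  | nil => simp [leftProd, rightProd]
  | cons w l ih =>
    obtain ⟨hwl, hl⟩ := List.nodup_cons.1 hl
    obtain ⟨hyw, hyl⟩ := List.ne_and_not_mem_of_not_mem_cons hy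
    obtain ⟨hzw, hzl⟩ := List.ne_and_not_mem_of_not_mem_cons hz
    have left_commute : Commute (r y w) (leftProd r l z) := commute_leftProd fun j hj =>
      hc _ _ _ _ hyw (ne_of_mem_of_not_mem hj hzl) (ne_of_mem_of_not_mem hj hyl).symm hyz
        (ne_of_mem_of_not_mem hj hwl).symm hzw.symm
    have right_commute : Commute (r w z) (rightProd r y l) := commute_rightProd fun j hj =>
      hc _ _ _ _ hzw.symm (ne_of_mem_of_not_mem hj hyl).symm hyw.symm
        (ne_of_mem_of_not_mem hj hwl).symm hyz.symm (ne_of_mem_of_not_mem hj hzl).symm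
    rw [leftProd_cons, rightProd_cons]
    calc leftProd r l z * r w z * r y z * (r y w * rightProd r y l)
        = leftProd r l z * (r w z * r y z * r y w) * rightProd r y l := by simp only [mul_assoc]
      _ = (leftProd r l z * r y w) * r y z * (r w z * rightProd r y l) := by
          rw [← hyb y w z hyw hyz hzw.symm]
          simp only [mul_assoc]
      _ = r y w * (leftProd r l z * r y z * rightProd r y l) * r w z := by
          rw [← left_commute.eq, right_commute.eq]
          simp only [mul_assoc]
      _ = _ := by
          rw [ih hl hyl hzl]
          simp only [mul_assoc]

theorem DisjointCommute.commute_leftProd_mul_leftProd (hc : DisjointCommute r) {a b : ι}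
    (hab : a ≠ b) {x : M} {l : List ι} (hl : l.Nodup) (ha : a ∉ l) (hb : b ∉ l)
    (hx : ∀ y ∈ l, Commute (r y b * r y a) x) :
    Commute (leftProd r l b * leftProd r l a) x := by
  induction l with
  | nil => simp [leftProd]
  | cons y l ih =>
    obtain ⟨hyl, hl⟩ := List.nodup_cons.1 hl
    obtain ⟨hay, hal⟩ := List.ne_and_not_mem_of_not_mem_cons ha
    obtain ⟨hby, hbl⟩ := List.ne_and_not_mem_of_not_mem_cons hb
    have left_commute : Commute (r y b) (leftProd r l a) := commute_leftProd fun j hj =>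
      hc _ _ _ _ hby.symm (ne_of_mem_of_not_mem hj hal) (ne_of_mem_of_not_mem hj hyl).symm hay.symm
        (ne_of_mem_of_not_mem hj hbl).symm hab.symm
    rw [leftProd_cons, leftProd_cons, left_commute.mul_mul_mul_comm]
    exact (ih hl hal hbl fun w hw => hx w (List.mem_cons_of_mem _ hw)).mul_left
      (hx y List.mem_cons_self)

theorem commute_leftProd_append_pair {a b z : ι} {x : M} {l l' : List ι}
    (hx : ∀ j ∈ l ++ l', Commute x (r j z)) (hab : Commute (r b z * r a z) x) :
    Commute (leftProd r (l ++ a :: b :: l') z) x := by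
  rw [leftProd_append, leftProd_cons, leftProd_cons, mul_assoc (leftProd r l' z)]
  exact ((commute_leftProd fun j hj => hx j (List.mem_append_right l hj)).symm.mul_left
    hab).mul_left (commute_leftProd fun j hj => hx j (List.mem_append_left l' hj)).symm

variable [LinearOrder ι]

/-- The product of `leftProd r {j ∈ l | j < n} n` with `n` decreasing along `l`, the abstract form
of `eta`. -/
def listEta (r : ι → ι → M) (l : List ι) : M :=
  (l.reverse.map fun n => leftProd r (l.filter (fun j => j < n)) n).prod

/-- The product of `rightProd r n {j ∈ l | n < j}` with `n` increasing along `l`, the abstract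
form of `etaOp`. -/
def listEtaOp (r : ι → ι → M) (l : List ι) : M :=
  (l.map fun n => rightProd r n (l.filter (fun j => n < j))).prod

theorem listEta_append_singleton {l : List ι} {z : ι} (h : (l ++ [z]).Pairwise (· < ·)) :
    listEta r (l ++ [z]) = leftProd r l z * listEta r l := by
  have hz : ∀ x ∈ l, x < z := fun x hx =>
    (List.pairwise_append.1 h).2.2 x hx z (List.mem_singleton_self z)
  have filter_last : (l ++ [z]).filter (· < z) = l := by
    rw [List.filter_append, List.filter_eq_self.2 (by simpa using hz)]
    simp
  have filter_of_mem : ∀ n ∈ l, (l ++ [z]).filter (· < n) = l.filter (· < n) := fun n hn => by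
    rw [List.filter_append]
    simp [(hz n hn).le]
  rw [listEta, List.reverse_append, List.reverse_singleton, List.singleton_append, List.map_cons,
    List.prod_cons, filter_last, listEta]
  refine congrArg (fun m : List M => leftProd r l z * m.prod) (List.map_congr_left fun n hn => ?_)
  rw [filter_of_mem n (List.mem_reverse.1 hn)]

theorem listEtaOp_cons {y : ι} {l : List ι} (h : (y :: l).Pairwise (· < ·)) :
    listEtaOp r (y :: l) = rightProd r y l * listEtaOp r l := by
  have hy : ∀ x ∈ l, y < x := (List.pairwise_cons.1 h).1
  have filter_head : (y :: l).filter (y < ·) = l := by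
    rw [List.filter_cons, List.filter_eq_self.2 (by simpa using hy)]
    simp
  have filter_of_mem : ∀ n ∈ l, (y :: l).filter (n < ·) = l.filter (n < ·) := fun n hn => by
    rw [List.filter_cons, if_neg (by simpa using (hy n hn).le)]
  rw [listEtaOp, List.map_cons, List.prod_cons, filter_head, listEtaOp]
  refine congrArg (fun m : List M => rightProd r y l * m.prod) (List.map_congr_left fun n hn => ?_)
  rw [filter_of_mem n hn]

theorem commute_listEta {x : M} {l : List ι} (h : ∀ i ∈ l, ∀ j ∈ l, i < j → Commute x (r i j)) :
    Commute x (listEta r l) := by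
  refine Commute.list_prod_right _ _ (List.forall_mem_map.2 fun n hn => commute_leftProd ?_)
  intro j hj
  obtain ⟨hj, hjn⟩ := List.mem_filter.1 hj
  exact h j hj n (List.mem_reverse.1 hn) (of_decide_eq_true hjn)

theorem commute_listEtaOp {x : M} {l : List ι} (h : ∀ i ∈ l, ∀ j ∈ l, i < j → Commute x (r i j)) :
    Commute x (listEtaOp r l) := by
  refine Commute.list_prod_right _ _ (List.forall_mem_map.2 fun n hn => commute_rightProd ?_)
  intro j hj
  obtain ⟨hj, hnj⟩ := List.mem_filter.1 hj
  exact h n hn j hj (of_decide_eq_true hnj)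

theorem YangBaxter.listEtaOp_append_singleton (hyb : YangBaxter r) (hc : DisjointCommute r)
    {l : List ι} {z : ι} (h : (l ++ [z]).Pairwise (· < ·)) :
    listEtaOp r (l ++ [z]) = leftProd r l z * listEtaOp r l := by
  induction l with
  | nil => simp [listEtaOp, leftProd, rightProd]
  | cons y l ih =>
    obtain ⟨hyl, -, hlz⟩ := List.pairwise_append.1 h
    have hz : ∀ j ∈ y :: l, j < z := fun j hj => hlz j hj z (List.mem_singleton_self z)
    rw [List.cons_append] at h ⊢
    have hnd : (y :: (l ++ [z])).Nodup := h.imp ne_of_lt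
    simp only [List.nodup_cons, List.mem_append, List.mem_singleton, not_or, List.nodup_append,
      forall_eq] at hnd
    obtain ⟨⟨hy, hyz⟩, hl, -, hz⟩ := hnd
    rw [listEtaOp_cons h, ih (List.pairwise_cons.1 h).2,
      rightProd_append_singleton, ← mul_assoc,
      ← hyb.leftProd_mul_rightProd hc hyz hl hy fun hzl => hz z hzl rfl, leftProd_cons,
      listEtaOp_cons hyl, mul_assoc]

theorem YangBaxter.listEta_eq_listEtaOp (hyb : YangBaxter r) (hc : DisjointCommute r)
    {l : List ι} (h : l.Pairwise (· < ·)) : listEta r l = listEtaOp r l := by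
  induction l using List.reverseRecOn with
  | nil => rfl
  | append_singleton l z ih =>
    rw [listEta_append_singleton h, ih (List.pairwise_append.1 h).1,
      hyb.listEtaOp_append_singleton hc h]

theorem DisjointCommute.listEtaOp_append_singleton (hc : DisjointCommute r) {l : List ι} {z : ι}
    (h : (l ++ [z]).Pairwise (· < ·)) :
    listEtaOp r (l ++ [z]) = listEtaOp r l * columnProd r l z := by
  induction l with
  | nil => simp [listEtaOp, columnProd, rightProd]
  | cons y l ih =>
    obtain ⟨hyl, -, hlz⟩ := List.pairwise_append.1 h
    have hz : ∀ j ∈ y :: l, j < z := fun j hj => hlz j hj z (List.mem_singleton_self z)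
    rw [List.cons_append] at h ⊢
    have hy : ∀ j ∈ l, y < j := (List.pairwise_cons.1 hyl).1
    have hcom : Commute (r y z) (listEtaOp r l) := commute_listEtaOp fun i hi j hj hij =>
      hc _ _ _ _ (hz y List.mem_cons_self).ne hij.ne (hy i hi).ne (hy j hj).ne
        (hz i (List.mem_cons_of_mem y hi)).ne' (hz j (List.mem_cons_of_mem y hj)).ne'
    rw [listEtaOp_cons h, ih (List.pairwise_cons.1 h).2, listEtaOp_cons hyl,
      rightProd_append_singleton, columnProd_cons, mul_assoc, ← mul_assoc (r y z), hcom.eq]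
    simp only [mul_assoc]

theorem star_listEta [StarMul M] (hc : DisjointCommute fun a b => star (r a b)) {l : List ι}
    (h : l.Pairwise (· < ·)) : star (listEta r l) = listEtaOp (fun a b => star (r a b)) l := by
  induction l using List.reverseRecOn with
  | nil => exact star_one M
  | append_singleton l z ih =>
    rw [listEta_append_singleton h, star_mul, ih (List.pairwise_append.1 h).1, star_leftProd,
      hc.listEtaOp_append_singleton h]

section Bond

variable {a b : ι} {x x' : M}

theorem semiconjBy_listEta_append_pair (hc : DisjointCommute r) (hab : SemiconjBy (r a b) x x')
    (hx : ∀ y z, y ≠ z → a ≠ y → a ≠ z → b ≠ y → b ≠ z → Commute (r y z) x)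
    (hleft : ∀ y, a ≠ y → b ≠ y → Commute (r y b * r y a) x)
    {l : List ι} (h : (l ++ [a, b]).Pairwise (· < ·)) :
    SemiconjBy (listEta r (l ++ [a, b])) x x' := by
  obtain ⟨hl, hlt, hlab⟩ := List.pairwise_append.1 h
  have hla : ∀ j ∈ l, j < a := fun j hj => hlab j hj a (by simp)
  have hlb : ∀ j ∈ l, j < b := fun j hj => hlab j hj b (by simp)
  have hlt : a < b := List.rel_of_pairwise_cons hlt (List.mem_singleton_self b)
  have append_eq : l ++ [a, b] = (l ++ [a]) ++ [b] := by simp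
  rw [append_eq] at h ⊢
  rw [listEta_append_singleton h, listEta_append_singleton (List.pairwise_append.1 h).1,
    leftProd_append, ← mul_assoc, mul_assoc (leftProd r [a] b)]
  have head : SemiconjBy (leftProd r [a] b) x x' := by simpa [leftProd] using hab
  have middle : SemiconjBy (leftProd r l b * leftProd r l a) x x :=
    hc.commute_leftProd_mul_leftProd hlt.ne (hl.imp ne_of_lt)
      (fun ha => (hla a ha).false) (fun hb => (hlb b hb).false)
      fun y hy => hleft y (hla y hy).ne' (hlb y hy).ne'
  have tail : SemiconjBy (listEta r l) x x :=
    (commute_listEta fun i hi j hj hij => (hx i j hij.ne (hla i hi).ne' (hla j hj).ne'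
      (hlb i hi).ne' (hlb j hj).ne').symm).symm
  exact (head.mul_left middle).mul_left tail

theorem semiconjBy_listEta (hc : DisjointCommute r) (hab : SemiconjBy (r a b) x x')
    (hx : ∀ y z, y ≠ z → a ≠ y → a ≠ z → b ≠ y → b ≠ z → Commute (r y z) x)
    (hx' : ∀ y z, y ≠ z → a ≠ y → a ≠ z → b ≠ y → b ≠ z → Commute (r y z) x')
    (hleft : ∀ y, a ≠ y → b ≠ y → Commute (r y b * r y a) x)
    (hright : ∀ z, a ≠ z → b ≠ z → Commute (r b z * r a z) x')
    {l l' : List ι} (h : (l ++ a :: b :: l').Pairwise (· < ·)) :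
    SemiconjBy (listEta r (l ++ a :: b :: l')) x x' := by
  induction l' using List.reverseRecOn with
  | nil => exact semiconjBy_listEta_append_pair hc hab hx hleft h
  | append_singleton l' z ih =>
    have append_eq : l ++ a :: b :: (l' ++ [z]) = (l ++ a :: b :: l') ++ [z] := by simp
    rw [append_eq] at h ⊢
    obtain ⟨hl, -, hlz⟩ := List.pairwise_append.1 h
    have hz : ∀ j ∈ l ++ a :: b :: l', j ≠ z := fun j hj =>
      (hlz j hj z (List.mem_singleton_self z)).ne
    have hnd : (a :: b :: (l ++ l')).Nodup := by
      have hperm : (l ++ a :: b :: l').Perm (a :: b :: (l ++ l')) :=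
        List.perm_middle.trans (List.perm_middle.cons a)
      exact hperm.nodup_iff.1 (hl.imp ne_of_lt)
    have haz : a ≠ z := hz a (by simp)
    have hbz : b ≠ z := hz b (by simp)
    rw [listEta_append_singleton h]
    refine SemiconjBy.mul_left (commute_leftProd_append_pair (fun j hj => ?_)
      (hright z haz hbz)) (ih hl)
    have haj : a ≠ j := by grind
    have hbj : b ≠ j := by grind
    exact (hx' j z (hz j (by grind)) haj haz hbj hbz).symm

end Bond

end OrderedProducts

/-! ### The metric operators -/

section Metric

variable {N d : ℕ}

theorem disjointCommute_embed (R : TwoSite d) :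
    DisjointCommute fun a b : Fin N => embed R a b :=
  fun _ _ _ _ hab hce hac hae hbc hbe => embed_commute_embed R R hab hce hac hae hbc hbe

theorem eta_eq_listEta (R : TwoSite d) :
    eta N R = listEta (fun a b => embed R a b) (List.finRange N) := rfl

theorem IsRMatrix.eta_eq_etaOp {C R : TwoSite d} (h : IsRMatrix N C R) : eta N R = etaOp N R :=
  YangBaxter.listEta_eq_listEtaOp (fun _ _ _ => h.yangBaxter) (disjointCommute_embed R)
    (List.pairwise_lt_finRange N)

theorem conjTranspose_eta (R : TwoSite d) : (eta N R)ᴴ = etaOp N Rᴴ := by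
  have star_embed : (fun a b : Fin N => star (embed R a b)) = fun a b => embed Rᴴ a b :=
    funext₂ fun a b => conjTranspose_embed R a b
  have h := star_listEta (r := fun a b => embed R a b)
    (star_embed ▸ disjointCommute_embed Rᴴ) (List.pairwise_lt_finRange N)
  rwa [star_embed] at h

theorem bondL_ne_bondR (n : Fin (N - 1)) : (bondL n : Fin N) ≠ bondR n := by
  simp [bondL, bondR]

theorem exists_finRange_eq_append (n : Fin (N - 1)) :
    ∃ l l' : List (Fin N), List.finRange N = l ++ bondL n :: bondR n :: l' := by
  have hL : (n : ℕ) < (List.finRange N).length := by simp; omega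
  have hR : (n : ℕ) + 1 < (List.finRange N).length := by simp; omega
  have getElem_bondL : bondL n = (List.finRange N)[(n : ℕ)] := by simp [bondL]
  have getElem_bondR : bondR n = (List.finRange N)[(n : ℕ) + 1] := by simp [bondR]
  refine ⟨(List.finRange N).take n, (List.finRange N).drop (n + 1 + 1), ?_⟩
  rw [getElem_bondL, getElem_bondR, ← List.drop_eq_getElem_cons hR,
    ← List.drop_eq_getElem_cons hL, List.take_append_drop]

theorem IsRMatrix.semiconj_eta {C R : TwoSite d} (h : IsRMatrix N C R) (n : Fin (N - 1)) :
    SemiconjBy (eta N R) (embed C (bondL n) (bondR n)) (embed C (bondR n) (bondL n)) := by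
  obtain ⟨l, l', hl⟩ := exists_finRange_eq_append n
  have hn := bondL_ne_bondR n
  have hbond : SemiconjBy (embed R (bondL n) (bondR n)) (embed C (bondL n) (bondR n))
      (embed C (bondR n) (bondL n)) := by
    rw [← embed_swapConj C (bondL n)]
    exact embed_semiconj hn h.semiconj
  rw [eta_eq_listEta, hl]
  exact semiconjBy_listEta (disjointCommute_embed R) hbond
    (fun _ _ hyz hLy hLz hRy hRz =>
      embed_commute_embed _ _ hyz hn hLy.symm hRy.symm hLz.symm hRz.symm)
    (fun _ _ hyz hLy hLz hRy hRz =>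
      embed_commute_embed _ _ hyz hn.symm hRy.symm hLy.symm hRz.symm hLz.symm)
    (fun _ hL hR => h.commute_second hn hL hR) (fun _ hL hR => h.commute_first hn.symm hR hL)
    (hl ▸ List.pairwise_lt_finRange N)

end Metric

/-! ### The Clebsch–Gordan decomposition -/

section ClebschGordan

variable {γ : ℝ} {d s : ℕ}

theorem totalWeight_eq (x : Fin (d + 1) × Fin (d + 1)) :
    totalWeight d x = (x.1 : ℝ) + (x.2 : ℝ) - d := by
  simp only [totalWeight, weight]
  ring

theorem coK_eq_diagonal : coK γ d = Matrix.diagonal fun x => qPow γ (totalWeight d x) := by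
  simp only [coK, spinK, Matrix.diagonal_kronecker_diagonal, ← qPow_add, totalWeight]

theorem coF_mulVec (g : ℕ → ℕ → ℂ) (x : Fin (d + 1) × Fin (d + 1)) :
    (coF γ d *ᵥ fun y => g y.1 y.2) x =
      ladder γ d x.1 * qPow γ (-weight d x.2) * g (x.1 + 1) x.2 +
        qPow γ (weight d x.1) * ladder γ d x.2 * g x.1 (x.2 + 1) := by
  have first_factor : ((spinF γ d ⊗ₖ spinKInv γ d) *ᵥ fun y => g y.1 y.2) x =
      ladder γ d x.1 * qPow γ (-weight d x.2) * g (x.1 + 1) x.2 := by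
    rw [Matrix.mulVec, dotProduct, Fintype.sum_prod_type]
    simp only [Matrix.kroneckerMap_apply, spinKInv, Matrix.diagonal_apply, mul_ite, ite_mul,
      mul_zero, zero_mul, Finset.sum_ite_eq, Finset.mem_univ, if_true]
    rw [mul_right_comm, ← sum_spinF_mul (fun i => g i x.2), Finset.sum_mul]
    exact Finset.sum_congr rfl fun i _ => mul_right_comm _ _ _
  have second_factor : ((spinK γ d ⊗ₖ spinF γ d) *ᵥ fun y => g y.1 y.2) x =
      qPow γ (weight d x.1) * ladder γ d x.2 * g x.1 (x.2 + 1) := by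
    rw [Matrix.mulVec, dotProduct, Fintype.sum_prod_type_right]
    simp only [Matrix.kroneckerMap_apply, spinK, Matrix.diagonal_apply, ite_mul,
      zero_mul, Finset.sum_ite_eq, Finset.mem_univ, if_true]
    rw [mul_assoc, ← sum_spinF_mul (fun i => g x.1 i), Finset.mul_sum]
    exact Finset.sum_congr rfl fun i _ => mul_assoc _ _ _
  rw [coF, Matrix.add_mulVec, Pi.add_apply, first_factor, second_factor]

/-- The vector `v` of the tensor square has weight `w`. -/
def HasWeight (v : Fin (d + 1) × Fin (d + 1) → ℂ) (w : ℝ) : Prop :=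
  ∀ x, v x ≠ 0 → totalWeight d x = w

namespace HasWeight

variable {v : Fin (d + 1) × Fin (d + 1) → ℂ} {w : ℝ}

theorem smul (h : HasWeight v w) (c : ℂ) : HasWeight (c • v) w := fun x hx =>
  h x (right_ne_zero_of_mul hx)

theorem coE_mulVec (h : HasWeight v w) : HasWeight (coE γ d *ᵥ v) (w + 1) := by
  intro x hx
  obtain ⟨y, -, hy⟩ := Finset.exists_ne_zero_of_sum_ne_zero hx
  rw [totalWeight_of_coE_apply_ne_zero (left_ne_zero_of_mul hy), h y (right_ne_zero_of_mul hy)]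

theorem diagonal_mulVec (h : HasWeight v w) (f : ℝ → ℂ) :
    (Matrix.diagonal fun x => f (totalWeight d x)) *ᵥ v = f w • v := by
  ext x
  rw [Matrix.mulVec_diagonal, Pi.smul_apply, smul_eq_mul]
  by_cases hx : v x = 0
  · rw [hx, mul_zero, mul_zero]
  · rw [h x hx]

theorem coF_mulVec_coE_mulVec (h1 : qNum γ 1 ≠ 0) (h : HasWeight v w) :
    coF γ d *ᵥ coE γ d *ᵥ v = coE γ d *ᵥ coF γ d *ᵥ v - (qNum γ (2 * w) : ℂ) • v := by
  rw [← h.diagonal_mulVec fun t => (qNum γ (2 * t) : ℂ), ← co_commutator h1, Matrix.sub_mulVec,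
    Matrix.mulVec_mulVec, Matrix.mulVec_mulVec, sub_sub_cancel]

end HasWeight

theorem eq_zero_of_coF_mulVec_eq_zero (hf : qFactorial γ d ≠ 0)
    {v : Fin (d + 1) × Fin (d + 1) → ℂ} (hv : ∀ x, v x ≠ 0 → 0 < totalWeight d x)
    (h : coF γ d *ᵥ v = 0) : v = 0 := by
  set g : ℕ → ℕ → ℂ := fun i j =>
    if hij : i < d + 1 ∧ j < d + 1 then v (⟨i, hij.1⟩, ⟨j, hij.2⟩) else 0
  have hgv : (fun y : Fin (d + 1) × Fin (d + 1) => g y.1 y.2) = v :=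
    funext fun y => dif_pos ⟨y.1.is_lt, y.2.is_lt⟩
  have vanishing : ∀ i j, d < i + j → g i j = 0 := by
    intro i
    induction i with
    | zero => exact fun j hj => dif_neg (by omega)
    | succ i ih =>
      intro j hj
      by_cases hij : i + 1 < d + 1 ∧ j < d + 1
      · have hF := coF_mulVec (γ := γ) g (⟨i, by omega⟩, ⟨j, hij.2⟩)
        rw [hgv, h, Pi.zero_apply, ih (j + 1) (by omega), mul_zero, add_zero] at hF
        exact (mul_eq_zero.1 hF.symm).resolve_left
          (mul_ne_zero (ladder_ne_zero hf (by simpa using hij.1)) (Complex.exp_ne_zero _))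
      · exact dif_neg hij
  ext x
  by_contra hx
  have hpos := hv x hx
  rw [totalWeight_eq, sub_pos] at hpos
  exact hx ((congrFun hgv x).symm.trans (vanishing _ _ (by exact_mod_cast hpos)))

/-- The coefficients of the lowest weight vector of weight `-s`. The exponent and the factors of
the product come from solving `Δ(F) v = 0` recursively in the first index. -/
def lowestCoeff (γ : ℝ) (d s i : ℕ) : ℂ :=
  ∏ k ∈ Finset.range i,
    (-(qPow γ (-(s : ℝ) - 1) * ladder γ d (d - s - 1 - k)) / ladder γ d k)

/-- The lowest weight vector of weight `-s` in the tensor square. It is zero for `d < s`. -/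
def lowestVec (γ : ℝ) (d s : ℕ) : Fin (d + 1) × Fin (d + 1) → ℂ := fun x =>
  if (x.1 : ℕ) + x.2 + s = d then lowestCoeff γ d s x.1 else 0

theorem hasWeight_lowestVec : HasWeight (lowestVec γ d s) (-s) := by
  intro x hx
  have hs : ((x.1 : ℝ) + x.2 + s) = d := by exact_mod_cast (ite_ne_right_iff.1 hx).1
  rw [totalWeight_eq, ← hs]
  ring

theorem lowestVec_ne_zero (hsd : s ≤ d) : lowestVec γ d s ≠ 0 := fun h => by
  have := congrFun h (0, ⟨d - s, by omega⟩)
  simp [lowestVec, lowestCoeff, hsd] at this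

theorem coF_mulVec_lowestVec (hf : qFactorial γ d ≠ 0) : coF γ d *ᵥ lowestVec γ d s = 0 := by
  ext x
  refine (coF_mulVec (fun i j => if i + j + s = d then lowestCoeff γ d s i else 0) x).trans ?_
  by_cases hx : (x.1 : ℕ) + x.2 + 1 + s = d
  · have hladder := ladder_ne_zero hf (show (x.1 : ℕ) < d by omega)
    have hweight : qPow γ (weight d x.1) =
        qPow γ (-weight d x.2) * qPow γ (-(s : ℝ) - 1) := by
      have hd : (x.1 : ℝ) + x.2 + 1 + s = d := by exact_mod_cast hx
      rw [← qPow_add, weight, weight, ← hd]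
      congr 1
      ring
    rw [if_pos (by omega), if_pos (by omega), lowestCoeff, Finset.prod_range_succ, ← lowestCoeff,
      show d - s - 1 - (x.1 : ℕ) = x.2 by omega, hweight, Pi.zero_apply]
    field_simp
    ring
  · rw [if_neg (by omega), if_neg (by omega), mul_zero, mul_zero, add_zero, Pi.zero_apply]

theorem ladder_zero_mul_self (h1 : qNum γ 1 ≠ 0) : ladder γ d 0 * ladder γ d 0 = qNum γ d := by
  rw [ladder_mul_self, Nat.cast_zero, sub_zero, zero_add, qNum_one h1, mul_one]

theorem ladder_succ_mul_self (h1 : qNum γ 1 ≠ 0) (k : ℕ) :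
    ladder γ d (k + 1) * ladder γ d (k + 1) =
      ladder γ d k * ladder γ d k - qNum γ (2 * (k + 1) - d) := by
  have h := qNum_mul_qNum_sub h1 ((d : ℝ) / 2) ((k : ℝ) + 1 - d / 2)
  rw [ladder_mul_self, ladder_mul_self, ← Complex.ofReal_sub, ← sub_eq_zero, ← Complex.ofReal_sub,
    Complex.ofReal_eq_zero]
  ring_nf at h
  push_cast
  ring_nf
  linear_combination -h

/-- The basis of the summand `V^s`, obtained from the lowest weight vector by applying `E` and
normalizing as in the spin `s` module. The normalization divides by zero from the index
`2 * s + 1` on. -/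
def irrepVec (γ : ℝ) (d s : ℕ) : ℕ → Fin (d + 1) × Fin (d + 1) → ℂ
  | 0 => lowestVec γ d s
  | k + 1 => (ladder γ (2 * s) k)⁻¹ • (coE γ d *ᵥ irrepVec γ d s k)

theorem hasWeight_irrepVec (k : ℕ) : HasWeight (irrepVec γ d s k) (k - s) := by
  induction k with
  | zero => simpa [irrepVec] using hasWeight_lowestVec
  | succ k ih =>
    rw [Nat.cast_succ, add_sub_right_comm]
    exact ih.coE_mulVec.smul _

theorem coF_mulVec_coE_mulVec_irrepVec (h1 : qNum γ 1 ≠ 0) (hf : qFactorial γ d ≠ 0) (k : ℕ) :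
    coF γ d *ᵥ coE γ d *ᵥ irrepVec γ d s k =
      (ladder γ (2 * s) k * ladder γ (2 * s) k) • irrepVec γ d s k := by
  induction k with
  | zero =>
    rw [(hasWeight_irrepVec 0).coF_mulVec_coE_mulVec h1, irrepVec, coF_mulVec_lowestVec hf,
      Matrix.mulVec_zero, zero_sub, ← neg_smul, ladder_zero_mul_self h1, ← Complex.ofReal_neg,
      ← qNum_neg]
    congr 3
    push_cast
    ring
  | succ k ih =>
    rw [(hasWeight_irrepVec (k + 1)).coF_mulVec_coE_mulVec h1]
    have lower : coE γ d *ᵥ coF γ d *ᵥ irrepVec γ d s (k + 1) =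
        (ladder γ (2 * s) k * ladder γ (2 * s) k) • irrepVec γ d s (k + 1) := by
      rw [irrepVec, Matrix.mulVec_smul, ih, Matrix.mulVec_smul, Matrix.mulVec_smul,
        smul_comm]
    rw [lower, ← sub_smul, ladder_succ_mul_self h1]
    congr 4
    push_cast
    ring

theorem coE_mulVec_irrepVec (h1 : qNum γ 1 ≠ 0) (hf : qFactorial γ d ≠ 0)
    (hs : qFactorial γ (2 * s) ≠ 0) {k : ℕ} (hk : k ≤ 2 * s) :
    coE γ d *ᵥ irrepVec γ d s k = ladder γ (2 * s) k • irrepVec γ d s (k + 1) := by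
  rcases hk.lt_or_eq with hk | rfl
  · exact (smul_inv_smul₀ (ladder_ne_zero hs hk) _).symm
  · have hF := coF_mulVec_coE_mulVec_irrepVec (s := s) h1 hf (2 * s)
    rw [ladder_self, zero_mul, zero_smul] at hF
    rw [ladder_self, zero_smul]
    refine eq_zero_of_coF_mulVec_eq_zero hf (fun x hx => ?_) hF
    rw [(hasWeight_irrepVec (2 * s)).coE_mulVec x hx]
    push_cast
    linarith [(Nat.cast_nonneg s : (0 : ℝ) ≤ s)]

theorem coF_mulVec_irrepVec_succ (h1 : qNum γ 1 ≠ 0) (hf : qFactorial γ d ≠ 0)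
    (hs : qFactorial γ (2 * s) ≠ 0) {k : ℕ} (hk : k < 2 * s) :
    coF γ d *ᵥ irrepVec γ d s (k + 1) = ladder γ (2 * s) k • irrepVec γ d s k := by
  rw [irrepVec, Matrix.mulVec_smul, coF_mulVec_coE_mulVec_irrepVec h1 hf k, mul_smul,
    inv_smul_smul₀ (ladder_ne_zero hs hk)]

theorem irrepVec_ne_zero (h1 : qNum γ 1 ≠ 0) (hf : qFactorial γ d ≠ 0)
    (hs : qFactorial γ (2 * s) ≠ 0) (hsd : s ≤ d) {k : ℕ} (hk : k ≤ 2 * s) :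
    irrepVec γ d s k ≠ 0 := by
  induction k with
  | zero => exact lowestVec_ne_zero hsd
  | succ k ih =>
    intro h
    have hF := coF_mulVec_irrepVec_succ h1 hf hs hk
    rw [h, Matrix.mulVec_zero] at hF
    exact ih (by omega) ((smul_eq_zero.1 hF.symm).resolve_left (ladder_ne_zero hs hk))

/-- The embedding of the spin `s` module into the tensor square. -/
def irrepMatrix (γ : ℝ) (d s : ℕ) : Matrix (Fin (d + 1) × Fin (d + 1)) (Fin (2 * s + 1)) ℂ :=
  fun x k => irrepVec γ d s k x

theorem coE_mul_irrepMatrix (h1 : qNum γ 1 ≠ 0) (hf : qFactorial γ d ≠ 0)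
    (hs : qFactorial γ (2 * s) ≠ 0) :
    coE γ d * irrepMatrix γ d s = irrepMatrix γ d s * spinE γ (2 * s) := by
  ext x k
  calc (coE γ d *ᵥ irrepVec γ d s k) x
    _ = ladder γ (2 * s) k * irrepVec γ d s (k + 1) x :=
      congrFun (coE_mulVec_irrepVec h1 hf hs k.is_le) x
    _ = ∑ j, irrepMatrix γ d s x j * spinE γ (2 * s) j k := by
      rw [← sum_spinF_mul fun j => irrepVec γ d s j x]
      simp only [← transpose_spinE, Matrix.transpose_apply, irrepMatrix, mul_comm]

theorem coF_mul_irrepMatrix (h1 : qNum γ 1 ≠ 0) (hf : qFactorial γ d ≠ 0)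
    (hs : qFactorial γ (2 * s) ≠ 0) :
    coF γ d * irrepMatrix γ d s = irrepMatrix γ d s * spinF γ (2 * s) := by
  ext x k
  rw [Matrix.mul_apply (M := irrepMatrix γ d s)]
  simp only [spinF_apply]
  cases k using Fin.cases with
  | zero =>
    refine (congrFun (coF_mulVec_lowestVec hf) x).trans ?_
    simp only [Fin.val_zero, Nat.add_eq_zero_iff, one_ne_zero, and_false, if_false, mul_zero,
      Finset.sum_const_zero, Pi.zero_apply]
  | succ k =>
    refine (congrFun (coF_mulVec_irrepVec_succ h1 hf hs k.is_lt) x).trans ?_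
    have index_eq (j : Fin (2 * s + 1)) : (j : ℕ) + 1 = k.succ ↔ j = k.castSucc := by
      rw [Fin.val_succ, add_left_inj, Fin.ext_iff, Fin.val_castSucc]
    simp only [index_eq, mul_ite, mul_zero, Finset.sum_ite_eq', Finset.mem_univ, if_true]
    exact mul_comm _ _

theorem coK_mul_irrepMatrix :
    coK γ d * irrepMatrix γ d s = irrepMatrix γ d s * spinK γ (2 * s) := by
  ext x k
  have weight_eq : weight (2 * s) k = k - s := by
    rw [weight]
    push_cast
    ring
  rw [coK_eq_diagonal, spinK, Matrix.mul_diagonal, weight_eq]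
  exact (congrFun ((hasWeight_irrepVec k).diagonal_mulVec (qPow γ)) x).trans (mul_comm _ _)

theorem isIntertwiner_irrepMatrix (h1 : qNum γ 1 ≠ 0) (hf : qFactorial γ d ≠ 0)
    (hs : qFactorial γ (2 * s) ≠ 0) : IsIntertwiner γ d s (irrepMatrix γ d s) :=
  ⟨coE_mul_irrepMatrix h1 hf hs, coF_mul_irrepMatrix h1 hf hs, coK_mul_irrepMatrix⟩

theorem linearIndependent_irrepVec (h1 : qNum γ 1 ≠ 0) (hf : qFactorial γ d ≠ 0)
    (hs : qFactorial γ (2 * s) ≠ 0) (hsd : s ≤ d) :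
    LinearIndependent ℂ fun k : Fin (2 * s + 1) => irrepVec γ d s k := by
  refine Module.End.eigenvectors_linearIndependent' (coH d).mulVecLin
    (fun k : Fin (2 * s + 1) => (((k : ℕ) : ℝ) - s : ℝ)) (fun k l hkl => Fin.ext ?_) _ fun k =>
      Module.End.hasEigenvector_iff.2 ⟨Module.End.mem_eigenspace_iff.2 ?_,
        irrepVec_ne_zero h1 hf hs hsd k.is_le⟩
  · simpa using hkl
  · exact (hasWeight_irrepVec k).diagonal_mulVec _

theorem le_finrank_subV (h1 : qNum γ 1 ≠ 0) (hf : qFactorial γ d ≠ 0)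
    (hs : qFactorial γ (2 * s) ≠ 0) (hsd : s ≤ d) :
    2 * s + 1 ≤ Module.finrank ℂ (subV γ d s) := by
  have range_le : LinearMap.range (irrepMatrix γ d s).mulVecLin ≤ subV γ d s :=
    le_iSup₂_of_le _ (isIntertwiner_irrepMatrix h1 hf hs) le_rfl
  have injective : Function.Injective (irrepMatrix γ d s).mulVecLin :=
    Matrix.mulVec_injective_iff.2 (linearIndependent_irrepVec h1 hf hs hsd)
  calc 2 * s + 1
    _ = Module.finrank ℂ (LinearMap.range (irrepMatrix γ d s).mulVecLin) := by
      rw [LinearMap.finrank_range_of_inj injective, Module.finrank_fin_fun]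
    _ ≤ Module.finrank ℂ (subV γ d s) := Submodule.finrank_mono range_le

theorem qNum_eq_zero_of_qPow_eq_one {x : ℝ} (h0 : γ ≠ 0) (h : qPow γ x = 1) : qNum γ x = 0 := by
  have sin_eq_zero := congrArg Complex.im h
  rw [qPow_eq_cos_add_sin] at sin_eq_zero
  simp only [Complex.add_im, Complex.ofReal_im, Complex.mul_im, Complex.ofReal_re, Complex.I_im,
    Complex.I_re, Complex.one_im, mul_one, mul_zero, zero_add, add_zero] at sin_eq_zero
  rw [qNum, if_neg h0, sin_eq_zero, zero_div]

theorem qNum_natCast_sub_ne_zero (hf : qFactorial γ d ≠ 0) {m n : ℕ} (hmn : m ≠ n)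
    (hm : m ≤ n + d) (hn : n ≤ m + d) : qNum γ ((m : ℝ) - n) ≠ 0 := by
  rcases hmn.lt_or_gt with h | h
  · rw [← neg_sub, qNum_neg, neg_ne_zero, ← Nat.cast_sub h.le]
    exact qNum_natCast_ne_zero hf (by omega) (by omega)
  · rw [← Nat.cast_sub h.le]
    exact qNum_natCast_ne_zero hf (by omega) (by omega)

namespace IsIntertwiner

variable {T : Matrix (Fin (d + 1) × Fin (d + 1)) (Fin (2 * s + 1)) ℂ}
  {x : Fin (d + 1) × Fin (d + 1)} {k : Fin (2 * s + 1)}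

theorem coF_mul_coE_mul (hT : IsIntertwiner γ d s T) :
    coF γ d * coE γ d * T = T * (spinF γ (2 * s) * spinE γ (2 * s)) := by
  rw [Matrix.mul_assoc, hT.1, ← Matrix.mul_assoc, hT.2.1, Matrix.mul_assoc]

theorem coE_mul_coF_mul (hT : IsIntertwiner γ d s T) :
    coE γ d * coF γ d * T = T * (spinE γ (2 * s) * spinF γ (2 * s)) := by
  rw [Matrix.mul_assoc, hT.2.1, ← Matrix.mul_assoc, hT.1, Matrix.mul_assoc]

theorem qPow_totalWeight (hT : IsIntertwiner γ d s T) (hx : T x k ≠ 0) :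
    qPow γ (totalWeight d x) = qPow γ (weight (2 * s) k) := by
  have hK := congrFun (congrFun hT.2.2 x) k
  rw [coK_eq_diagonal, spinK, Matrix.diagonal_mul, Matrix.mul_diagonal, mul_comm] at hK
  exact mul_left_cancel₀ hx hK

theorem qNum_two_mul_totalWeight (h1 : qNum γ 1 ≠ 0) (hT : IsIntertwiner γ d s T)
    (hx : T x k ≠ 0) : qNum γ (2 * totalWeight d x) = qNum γ (2 * weight (2 * s) k) := by
  have hcomm : (coE γ d * coF γ d - coF γ d * coE γ d) * T =
      T * (spinE γ (2 * s) * spinF γ (2 * s) - spinF γ (2 * s) * spinE γ (2 * s)) := by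
    rw [Matrix.sub_mul, Matrix.mul_sub, hT.coE_mul_coF_mul, hT.coF_mul_coE_mul]
  rw [co_commutator h1, spin_commutator h1] at hcomm
  have hxk := congrFun (congrFun hcomm x) k
  rw [Matrix.diagonal_mul, Matrix.mul_diagonal, mul_comm] at hxk
  exact_mod_cast mul_left_cancel₀ hx hxk

-- For `γ = 0` the operator `K` is the identity and only the commutator of `E` and `F` sees the
-- weight.
theorem qNum_totalWeight_sub_weight (h1 : qNum γ 1 ≠ 0) (hT : IsIntertwiner γ d s T)
    (hx : T x k ≠ 0) : qNum γ (totalWeight d x - weight (2 * s) k) = 0 := by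
  by_cases h0 : γ = 0
  · have h := hT.qNum_two_mul_totalWeight h1 hx
    simp only [qNum, h0, if_true] at h ⊢
    linarith
  · refine qNum_eq_zero_of_qPow_eq_one h0 ?_
    rw [sub_eq_add_neg, qPow_add, hT.qPow_totalWeight hx, qPow_mul_qPow_neg]

theorem totalWeight_eq_weight (h1 : qNum γ 1 ≠ 0) (hg : qFactorial γ (2 * d) ≠ 0) (hsd : s ≤ d)
    (hT : IsIntertwiner γ d s T) (hx : T x k ≠ 0) : totalWeight d x = weight (2 * s) k := by
  have hq := hT.qNum_totalWeight_sub_weight h1 hx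
  have difference : totalWeight d x - weight (2 * s) k =
      ((x.1 + x.2 + s : ℕ) : ℝ) - ((d + k : ℕ) : ℝ) := by
    rw [totalWeight_eq, weight]
    push_cast
    ring
  rw [difference] at hq
  rw [← sub_eq_zero, difference, sub_eq_zero, Nat.cast_inj]
  by_contra hne
  exact qNum_natCast_sub_ne_zero hg hne (by omega) (by omega) hq

end IsIntertwiner

/-- The eigenvalue of the Casimir operator on the spin `s` module. -/
def casimirValue (γ : ℝ) (s : ℕ) : ℝ := qNum γ ((s : ℝ) + 1 / 2) ^ 2

theorem IsIntertwiner.casimir_mul {T : Matrix (Fin (d + 1) × Fin (d + 1)) (Fin (2 * s + 1)) ℂ}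
    (h1 : qNum γ 1 ≠ 0) (hg : qFactorial γ (2 * d) ≠ 0) (hsd : s ≤ d)
    (hT : IsIntertwiner γ d s T) : casimir γ d * T = (casimirValue γ s : ℂ) • T := by
  rw [casimir, Matrix.add_mul, hT.coF_mul_coE_mul, spinF_mul_spinE]
  ext x k
  rw [Matrix.add_apply, Matrix.mul_diagonal, casimirDiag, Matrix.diagonal_mul, Matrix.smul_apply,
    smul_eq_mul]
  by_cases hx : T x k = 0
  · rw [hx, zero_mul, mul_zero, mul_zero, add_zero]
  · rw [hT.totalWeight_eq_weight h1 hg hsd hx, mul_comm, ← add_mul, ← Complex.ofReal_add]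
    congr 2
    rw [casimirValue, ← eq_sub_iff_add_eq, qNum_sq_sub_sq, mul_comm, weight]
    push_cast
    congr 2 <;> ring

theorem subV_le_eigenspace_casimir (h1 : qNum γ 1 ≠ 0) (hg : qFactorial γ (2 * d) ≠ 0)
    (hsd : s ≤ d) :
    subV γ d s ≤ Module.End.eigenspace (casimir γ d).mulVecLin (casimirValue γ s : ℂ) := by
  refine iSup₂_le fun T hT => ?_
  rintro _ ⟨c, rfl⟩
  rw [Module.End.mem_eigenspace_iff, Matrix.mulVecLin_apply, Matrix.mulVecLin_apply,
    Matrix.mulVec_mulVec, hT.casimir_mul h1 hg hsd, Matrix.smul_mulVec]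

theorem casimirValue_injective (hg : qFactorial γ (2 * d) ≠ 0) :
    Function.Injective fun s : Fin (d + 1) => casimirValue γ s := by
  intro s l h
  by_contra hne
  have hsl : qNum γ ((s : ℝ) - l) ≠ 0 :=
    qNum_natCast_sub_ne_zero hg (Fin.val_ne_of_ne hne) (by omega) (by omega)
  have hsum : qNum γ ((s + l + 1 : ℕ) : ℝ) ≠ 0 := by
    refine qNum_natCast_ne_zero hg (Nat.succ_ne_zero _) ?_
    have := Fin.val_ne_of_ne hne
    omega
  refine mul_ne_zero hsum hsl ?_
  rw [← sub_eq_zero_of_eq (show casimirValue γ s = casimirValue γ l from h), casimirValue,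
    casimirValue, qNum_sq_sub_sq]
  push_cast
  congr 2 <;> ring

theorem iSupIndep_subV (h1 : qNum γ 1 ≠ 0) (hg : qFactorial γ (2 * d) ≠ 0) :
    iSupIndep fun s : Fin (d + 1) => subV γ d s :=
  ((Module.End.eigenspaces_iSupIndep (casimir γ d).mulVecLin).comp
    (Complex.ofReal_injective.comp (casimirValue_injective hg))).mono fun s =>
      subV_le_eigenspace_casimir h1 hg s.is_le

theorem isInternal_of_le_finrank {K V ι : Type*} [Field K] [AddCommGroup V] [Module K V]
    [FiniteDimensional K V] [Fintype ι] [DecidableEq ι] {A : ι → Submodule K V} (hA : iSupIndep A)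
    {n : ι → ℕ} (hn : ∀ i, n i ≤ Module.finrank K (A i)) (hsum : ∑ i, n i = Module.finrank K V) :
    DirectSum.IsInternal A ∧ ∀ i, Module.finrank K (A i) = n i := by
  have hinj : Function.Injective (DirectSum.coeLinearMap A) := hA.dfinsupp_lsum_injective
  have finrank_le := LinearMap.finrank_le_finrank_of_injective hinj
  rw [Module.finrank_directSum, ← hsum] at finrank_le
  have sum_eq := le_antisymm (Finset.sum_le_sum fun i _ => hn i) finrank_le
  refine ⟨⟨hinj, (LinearMap.injective_iff_surjective_of_finrank_eq_finrank ?_).1 hinj⟩, fun i =>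
    (((Finset.sum_eq_sum_iff_of_le fun i _ => hn i).1 sum_eq) i (Finset.mem_univ i)).symm⟩
  rw [Module.finrank_directSum, ← sum_eq, hsum]

theorem sum_range_two_mul_add_one (n : ℕ) : ∑ s ∈ Finset.range n, (2 * s + 1) = n * n := by
  induction n with
  | zero => rfl
  | succ n ih =>
    rw [Finset.sum_range_succ, ih]
    ring

theorem isInternal_subV (h1 : qNum γ 1 ≠ 0) (hg : qFactorial γ (2 * d) ≠ 0) :
    DirectSum.IsInternal (fun s : Fin (d + 1) => subV γ d s) ∧
      ∀ s : Fin (d + 1), Module.finrank ℂ (subV γ d s) = 2 * (s : ℕ) + 1 := by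
  refine isInternal_of_le_finrank (iSupIndep_subV h1 hg) (fun s => le_finrank_subV h1
    (qFactorial_ne_zero_of_le hg (by omega)) (qFactorial_ne_zero_of_le hg (by omega)) s.is_le) ?_
  rw [Module.finrank_fintype_fun_eq_card, Fintype.card_prod, Fintype.card_fin,
    Fin.sum_univ_eq_sum_range (fun s => 2 * s + 1), sum_range_two_mul_add_one]

end ClebschGordan

/-! ### The projectors as polynomials in the Casimir operator -/

section Projectors

open Polynomial

theorem semiconjBy_sum {A ι : Type*} [NonUnitalNonAssocSemiring A] {a : A} {x y : ι → A}
    (t : Finset ι) (h : ∀ i ∈ t, SemiconjBy a (x i) (y i)) :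
    SemiconjBy a (∑ i ∈ t, x i) (∑ i ∈ t, y i) := by
  rw [SemiconjBy, Finset.mul_sum, Finset.sum_mul]
  exact Finset.sum_congr rfl h

theorem semiconjBy_aeval {R A : Type*} [CommSemiring R] [Semiring A] [Algebra R A] {a x y : A}
    (h : SemiconjBy a x y) (p : R[X]) : SemiconjBy a (aeval x p) (aeval y p) := by
  induction p using Polynomial.induction_on' with
  | add p q hp hq =>
    rw [map_add, map_add]
    exact hp.add_right hq
  | monomial n c =>
    rw [aeval_monomial, aeval_monomial]
    exact SemiconjBy.mul_right (Algebra.commutes c a).symm (h.pow_right n)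

theorem star_aeval {R A : Type*} [CommSemiring R] [StarRing R] [TrivialStar R] [Semiring A]
    [StarRing A] [Algebra R A] [StarModule R A] (a : A) (p : R[X]) :
    star (aeval a p) = aeval (star a) p := by
  simp only [aeval_eq_sum_range, star_sum, star_smul, star_pow, star_trivial]

theorem aeval_mulVec_of_mem_eigenspace {m : Type*} [Fintype m] [DecidableEq m]
    {A : Matrix m m ℂ} {v : m → ℂ} {c : ℝ}
    (h : v ∈ Module.End.eigenspace A.mulVecLin (c : ℂ)) (p : ℝ[X]) :
    aeval A p *ᵥ v = ((p.eval c : ℝ) : ℂ) • v := by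
  by_cases hv : v = 0
  · rw [hv, Matrix.mulVec_zero, smul_zero]
  have hp := Module.End.aeval_apply_of_hasEigenvector (p := p.map (algebraMap ℝ ℂ))
    (Module.End.hasEigenvector_iff.2 ⟨h, hv⟩)
  have eval_eq : (p.map (algebraMap ℝ ℂ)).eval (c : ℂ) = (p.eval c : ℝ) :=
    eval_map_apply (algebraMap ℝ ℂ) c
  rw [← eval_eq, ← hp, ← aeval_map_algebraMap ℂ]
  exact congrArg (· v) (aeval_algHom_apply (Matrix.toLinAlgEquiv' (R := ℂ)) A _).symm

theorem isCompl_iSup_ne_of_isInternal {R M ι : Type*} [Ring R] [AddCommGroup M] [Module R M]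
    [DecidableEq ι] {A : ι → Submodule R M} (hA : DirectSum.IsInternal A) (i : ι) :
    IsCompl (A i) (⨆ l : {l : ι // l ≠ i}, A l) := by
  constructor
  · rw [iSup_subtype]
    exact hA.submodule_iSupIndep i
  · rw [codisjoint_iff_le_sup, ← hA.submodule_iSup_eq_top]
    refine iSup_le fun l => ?_
    by_cases h : l = i
    · exact h ▸ le_sup_left
    · exact le_sup_of_le_right (le_iSup_of_le ⟨l, h⟩ le_rfl)

theorem projection_eq_of_isInternal {R M ι : Type*} [Ring R] [AddCommGroup M] [Module R M]
    [DecidableEq ι] {A : ι → Submodule R M} (hA : DirectSum.IsInternal A) {i : ι}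
    {f : M →ₗ[R] M} (hi : ∀ v ∈ A i, f v = v) (hne : ∀ l, l ≠ i → ∀ v ∈ A l, f v = 0) :
    (A i).projection _ (isCompl_iSup_ne_of_isInternal hA i) = f := by
  rw [← LinearMap.eqLocus_eq_top, eq_top_iff, ← hA.submodule_iSup_eq_top]
  refine iSup_le fun l v hv => ?_
  rw [LinearMap.mem_eqLocus]
  by_cases h : l = i
  · subst h
    rw [hi v hv, Submodule.projection_apply_of_mem_left _ hv]
  · rw [hne l h v hv, Submodule.projection_apply_eq_zero_iff]
    exact Submodule.mem_iSup_of_mem ⟨l, h⟩ hv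

variable {γ : ℝ} {N d : ℕ}

/-- The Lagrange polynomial that is `1` at the Casimir value of spin `s` and `0` at the others. -/
def projPoly (γ : ℝ) (d : ℕ) (s : Fin (d + 1)) : ℝ[X] :=
  Lagrange.basis Finset.univ (fun l : Fin (d + 1) => casimirValue γ l) s

theorem proj_eq_aeval (h1 : qNum γ 1 ≠ 0) (hg : qFactorial γ (2 * d) ≠ 0) (s : Fin (d + 1)) :
    proj γ d s = aeval (casimir γ d) (projPoly γ d s) := by
  have hint := (isInternal_subV h1 hg).1
  have eigenvector {l : Fin (d + 1)} {v} (hv : v ∈ subV γ d l) :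
      aeval (casimir γ d) (projPoly γ d s) *ᵥ v =
        (((projPoly γ d s).eval (casimirValue γ l) : ℝ) : ℂ) • v :=
    aeval_mulVec_of_mem_eigenspace (subV_le_eigenspace_casimir h1 hg l.is_le hv) _
  have eval_self : (projPoly γ d s).eval (casimirValue γ s) = 1 :=
    Lagrange.eval_basis_self (casimirValue_injective hg).injOn (Finset.mem_univ s)
  have eval_of_ne {l : Fin (d + 1)} (h : l ≠ s) :
      (projPoly γ d s).eval (casimirValue γ l) = 0 :=
    Lagrange.eval_basis_of_ne (v := fun l : Fin (d + 1) => casimirValue γ l) h.symm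
      (Finset.mem_univ l)
  rw [proj, dif_pos (isCompl_iSup_ne_of_isInternal hint s),
    projection_eq_of_isInternal hint (f := Matrix.toLin' (aeval (casimir γ d) (projPoly γ d s))),
    LinearMap.toMatrix'_toLin']
  · intro v hv
    rw [Matrix.toLin'_apply, eigenvector hv, eval_self, Complex.ofReal_one, one_smul]
  · intro l hl v hv
    rw [Matrix.toLin'_apply, eigenvector hv, eval_of_ne hl, Complex.ofReal_zero, zero_smul]

theorem embed_proj (h1 : qNum γ 1 ≠ 0) (hg : qFactorial γ (2 * d) ≠ 0) (s : Fin (d + 1))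
    {a b : Fin N} (h : a ≠ b) :
    embed (proj γ d s) a b = aeval (embed (casimir γ d) a b) (projPoly γ d s) := by
  rw [proj_eq_aeval h1 hg]
  exact (aeval_algHom_apply ((embedHom h).restrictScalars ℝ) _ _).symm

theorem IsUnitary.conjTranspose_proj (hu : IsUnitary γ d) (h1 : qNum γ 1 ≠ 0)
    (hg : qFactorial γ (2 * d) ≠ 0) (s : Fin (d + 1)) :
    (proj γ d s)ᴴ = swapConj d (proj γ d s) := by
  rw [proj_eq_aeval h1 hg, ← Matrix.star_eq_conjTranspose, star_aeval,
    Matrix.star_eq_conjTranspose, hu.conjTranspose_casimir]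
  exact aeval_algHom_apply ((swapConj d).restrictScalars ℝ) _ _

theorem IsUnitary.conjTranspose_embed_proj (hu : IsUnitary γ d) (h1 : qNum γ 1 ≠ 0)
    (hg : qFactorial γ (2 * d) ≠ 0) (s : Fin (d + 1)) (a b : Fin N) :
    (embed (proj γ d s) a b)ᴴ = embed (proj γ d s) b a := by
  rw [conjTranspose_embed, hu.conjTranspose_proj h1 hg, embed_swapConj]

theorem IsRMatrix.eta_mul_embed_proj {R : TwoSite d} (hR : IsRMatrix N (casimir γ d) R)
    (h1 : qNum γ 1 ≠ 0) (hg : qFactorial γ (2 * d) ≠ 0) (n : Fin (N - 1)) (s : Fin (d + 1)) :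
    eta N R * embed (proj γ d s) (bondL n) (bondR n) =
      embed (proj γ d s) (bondR n) (bondL n) * eta N R := by
  rw [embed_proj h1 hg s (bondL_ne_bondR n), embed_proj h1 hg s (bondL_ne_bondR n).symm]
  exact semiconjBy_aeval (hR.semiconj_eta n) _

theorem IsUnitary.conjTranspose_hamiltonian (hu : IsUnitary γ d) (h1 : qNum γ 1 ≠ 0)
    (hg : qFactorial γ (2 * d) ≠ 0) (b : Fin (N - 1) → Fin (d + 1) → ℝ) :
    (hamiltonian γ N d b)ᴴ =
      ∑ n, ∑ s, (b n s : ℂ) • embed (proj γ d s) (bondR n) (bondL n) := by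
  simp only [hamiltonian, Matrix.conjTranspose_sum, Matrix.conjTranspose_smul,
    hu.conjTranspose_embed_proj h1 hg, Complex.star_def, Complex.conj_ofReal]

theorem IsRMatrix.eta_mul_hamiltonian {R : TwoSite d} (hR : IsRMatrix N (casimir γ d) R)
    (hu : IsUnitary γ d) (h1 : qNum γ 1 ≠ 0) (hg : qFactorial γ (2 * d) ≠ 0)
    (b : Fin (N - 1) → Fin (d + 1) → ℝ) :
    eta N R * hamiltonian γ N d b = (hamiltonian γ N d b)ᴴ * eta N R := by
  rw [hu.conjTranspose_hamiltonian h1 hg]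
  exact semiconjBy_sum _ fun n _ => semiconjBy_sum _ fun s _ =>
    SemiconjBy.smul_right (hR.eta_mul_embed_proj h1 hg n s) _

end Projectors

end

end SpinChain

theorem proposition2_general (d : ℕ) (hd : 1 ≤ d) (γ : ℝ) (hu : SpinChain.IsUnitary γ d) (N : ℕ) :
    IsUnit (SpinChain.RPlus γ d) ∧
    ((∀ m : ℕ, 1 ≤ m → m ≤ 2 * d → SpinChain.qNum γ m ≠ 0) →
      (DirectSum.IsInternal (fun s : Fin (d + 1) => SpinChain.subV γ d s) ∧
        ∀ s : Fin (d + 1), Module.finrank ℂ (SpinChain.subV γ d s) = 2 * (s : ℕ) + 1) ∧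
      ∀ R ∈ ({SpinChain.RPlus γ d, SpinChain.RMinus γ d} : Set (SpinChain.TwoSite d)),
        (∀ (n : Fin (N - 1)) (s : Fin (d + 1)),
          SpinChain.eta N R *
              SpinChain.embed (SpinChain.proj γ d s) (SpinChain.bondL n) (SpinChain.bondR n) =
            (SpinChain.embed (SpinChain.proj γ d s)
              (SpinChain.bondL n) (SpinChain.bondR n)).conjTranspose * SpinChain.eta N R ∧
          (SpinChain.embed (SpinChain.proj γ d s)
              (SpinChain.bondL n) (SpinChain.bondR n)).conjTranspose * SpinChain.eta N R =
            SpinChain.embed (SpinChain.proj γ d s) (SpinChain.bondR n) (SpinChain.bondL n) *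
              SpinChain.eta N R) ∧
        ∀ b : Fin (N - 1) → Fin (d + 1) → ℝ,
          SpinChain.eta N R * SpinChain.hamiltonian γ N d b =
            (SpinChain.hamiltonian γ N d b).conjTranspose * SpinChain.eta N R) ∧
    (SpinChain.eta N (SpinChain.RPlus γ d) = SpinChain.etaOp N (SpinChain.RPlus γ d) ∧
      SpinChain.eta N (SpinChain.RMinus γ d) = SpinChain.etaOp N (SpinChain.RMinus γ d)) ∧
    (SpinChain.eta N (SpinChain.RPlus γ d)).conjTranspose =
      SpinChain.eta N (SpinChain.RMinus γ d) := by
  have h1 := hu.qNum_one_ne_zero (by omega)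
  have hf := hu.qFactorial_ne_zero
  refine ⟨SpinChain.isUnit_RPlus hf, fun hm => ?_,
    ⟨(SpinChain.isRMatrix_RPlus h1 hf).eta_eq_etaOp,
      (SpinChain.isRMatrix_RMinus h1 hf).eta_eq_etaOp⟩, ?_⟩
  · have hg := SpinChain.qFactorial_ne_zero_of_forall hm
    refine ⟨SpinChain.isInternal_subV h1 hg, fun R hR => ?_⟩
    have hR : SpinChain.IsRMatrix N (SpinChain.casimir γ d) R := by
      rcases hR with rfl | rfl
      exacts [SpinChain.isRMatrix_RPlus h1 hf, SpinChain.isRMatrix_RMinus h1 hf]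
    refine ⟨fun n s => ?_, hR.eta_mul_hamiltonian hu h1 hg⟩
    rw [hu.conjTranspose_embed_proj h1 hg]
    exact ⟨hR.eta_mul_embed_proj h1 hg n s, rfl⟩
  · rw [(SpinChain.isRMatrix_RMinus h1 hf).eta_eq_etaOp, SpinChain.conjTranspose_eta,
      hu.conjTranspose_RPlus]

theorem proposition2 (d : ℕ) (hd : 1 ≤ d) (γ : ℝ) (hγ : (d : ℝ) * |γ| < Real.pi) (N : ℕ) :
    -- the R-matrix is invertible
    IsUnit (SpinChain.RPlus γ d) ∧
    -- part a), for those γ at which no denominator [m] of the projectors vanishes; first the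
    -- decomposition of the tensor square that defines the projectors
    ((∀ m : ℕ, 1 ≤ m → m ≤ 2 * d → SpinChain.qNum γ m ≠ 0) →
      (DirectSum.IsInternal (fun s : Fin (d + 1) => SpinChain.subV γ d s) ∧
        ∀ s : Fin (d + 1), Module.finrank ℂ (SpinChain.subV γ d s) = 2 * (s : ℕ) + 1) ∧
      ∀ R ∈ ({SpinChain.RPlus γ d, SpinChain.RMinus γ d} : Set (SpinChain.TwoSite d)),
        (∀ (n : Fin (N - 1)) (s : Fin (d + 1)),
          SpinChain.eta N R *
              SpinChain.embed (SpinChain.proj γ d s) (SpinChain.bondL n) (SpinChain.bondR n) =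
            (SpinChain.embed (SpinChain.proj γ d s)
              (SpinChain.bondL n) (SpinChain.bondR n)).conjTranspose * SpinChain.eta N R ∧
          (SpinChain.embed (SpinChain.proj γ d s)
              (SpinChain.bondL n) (SpinChain.bondR n)).conjTranspose * SpinChain.eta N R =
            SpinChain.embed (SpinChain.proj γ d s) (SpinChain.bondR n) (SpinChain.bondL n) *
              SpinChain.eta N R) ∧
        ∀ b : Fin (N - 1) → Fin (d + 1) → ℝ,
          SpinChain.eta N R * SpinChain.hamiltonian γ N d b =
            (SpinChain.hamiltonian γ N d b).conjTranspose * SpinChain.eta N R) ∧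
    -- part b)
    (SpinChain.eta N (SpinChain.RPlus γ d) = SpinChain.etaOp N (SpinChain.RPlus γ d) ∧
      SpinChain.eta N (SpinChain.RMinus γ d) = SpinChain.etaOp N (SpinChain.RMinus γ d)) ∧
    -- part c)
    (SpinChain.eta N (SpinChain.RPlus γ d)).conjTranspose =
      SpinChain.eta N (SpinChain.RMinus γ d) := by
  exact proposition2_general d hd γ (SpinChain.isUnitary_of_mul_abs_lt_pi
    ((le_mul_of_one_le_left (abs_nonneg γ) (by exact_mod_cast hd)).trans_lt hγ) hγ) N
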